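/- Let $k$ be a field and let $A$ be a (left and right) noetherian Hopf $k$-algebra with counit $\epsilon$ and bijective antipode $S$. Let $d\ge 0$ be an integer and assume that $A$ is Artin–Schelter regular of dimension $d$: the left and the right injective dimension of $A$ are equal to $d$; $\dim_k \operatorname{Ext}^d_A({}_Ak,{}_AA)=1$ and $\operatorname{Ext}^i_A({}_Ak,{}_AA)=0$ for $i\neq d$, where $k=A/\ker\epsilon$; the same holds for right modules; and the global dimension of $A$ is $d$. The right multiplication of $A$ on itself makes the one-dimensional space $\operatorname{Ext}^d_A({}_Ak,{}_AA)$ a right $A$-module; let $\pi_0:A\to k$ be the algebra homomorphism with $e\cdot a=\pi_0(a)e$ for all $e$ in this space and $a\in A$. Let $\xi$ be the algebra automorphism $\xi(a)=\sum \pi_0(a_1)a_2$ of $A$, where $\Delta(a)=\sum a_1\otimes a_2$, and put $\nu=\xi S^2$, an algebra automorphism of $A$. For $k$-algebra automorphisms $\sigma,\tau$ of $A$ let ${}^\sigma A^\tau$ be the $A$-bimodule with underlying space $A$ and actions $a\cdot m\cdot b=\sigma(a)m\tau(b)$; an identity automorphism is omitted from the notation. For an $A$-bimodule $M$, on which $k$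 acts centrally, let $H^i(A,M)$ be Hochschild cohomology, let $[A,M]$ be the $k$-span of all $am-ma$ with $a\in A$, $m\in M$, and let $A^e=A\otimes_k A^{\mathrm{op}}$. Then the following hold. (a) For every $k$-algebra automorphism $\sigma$ of $A$ there are isomorphisms of $k$-vector spaces $$H^d(A,{}^\sigma A)\;\cong\; A\otimes_{A^e}{}^{\nu^{-1}\sigma}A\;=\;{}^{\nu^{-1}\sigma}A/[A,{}^{\nu^{-1}\sigma}A],$$ where the last identification is induced by $x\otimes m\mapsto xm$. (b) In particular $H^d(A,{}^\nu A)\cong A/[A,A]\neq 0$, and $d$ is the largest integer $i$ such that $H^i(A,{}^\sigma A)\ne 0$ for some $k$-algebra automorphism $\sigma$ of $A$; that is, $\operatorname{THcodim}A=d$. (c) $\operatorname{Hcodim}A=d$, that is, $d$ is the largest integer $i$ with $H^i(A,A)\neq 0$, if and only if $A^\nu/[A,A^\nu]\neq 0$. -/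

import Mathlib

open scoped TensorProduct

universe u v w

namespace HopfDuality

section Hochschild

/-!
### Hochschild cohomology of an algebra with coefficients in a bimodule

A bimodule over the `k`-algebra `A` (central over `k`) is a left `A`-module `M` that is also a
right `A`-module, i.e. a module over `Aᵐᵒᵖ`; the product `m · b` is `MulOpposite.op b • m`.
-/

/-- Multiplying two adjacent entries of a tuple is affected by a change of one entry only through
a linear map into one entry. -/
theorem contractNth_update {k : Type u} {A : Type v} [CommSemiring k] [Semiring A] [Algebra k A]
    {n : ℕ} [DecidableEq (Fin (n + 1))] (j : Fin n) (v : Fin (n + 1) → A) (i : Fin (n + 1)) :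
    ∃ (p : Fin n) (L : A →ₗ[k] A), ∀ x : A,
      Fin.contractNth j.castSucc (· * ·) (Function.update v i x) =
        Function.update (Fin.contractNth j.castSucc (· * ·) v) p (L x) := by
  rcases lt_trichotomy (i : ℕ) (j : ℕ) with h | h | h
  · refine ⟨⟨i, by omega⟩, LinearMap.id, fun x ↦ ?_⟩
    ext q
    by_cases hq : q = ⟨i, by omega⟩
    · subst hq
      have : (Fin.castSucc ⟨(i : ℕ), by omega⟩ : Fin (n + 1)) = i := by ext; simp
      simp [Fin.contractNth, h, this]
    · have h1 : q.castSucc ≠ i := fun e ↦ hq (by ext; simp [← e])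
      have hq' : (q : ℕ) ≠ i := fun e ↦ hq (by ext; simp [e])
      rw [Function.update_of_ne hq]
      simp only [Fin.contractNth, Function.update_of_ne h1, Fin.val_castSucc]
      split_ifs with h2 h3
      · rfl
      · rw [Function.update_of_ne]; intro e; have := congrArg Fin.val e; simp at this; omega
      · rw [Function.update_of_ne]; intro e; have := congrArg Fin.val e; simp at this; omega
  · refine ⟨j, LinearMap.mulRight k (v j.succ), fun x ↦ ?_⟩
    have hi : i = j.castSucc := by ext; simp [h]
    subst hi
    ext q
    by_cases hq : q = j
    · subst hq
      have : q.succ ≠ q.castSucc := by intro e; have := congrArg Fin.val e; simp at this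
      simp [Fin.contractNth, Function.update_of_ne this]
    · have hq' : (q : ℕ) ≠ j := fun e ↦ hq (by ext; simp [e])
      have h1 : q.castSucc ≠ j.castSucc := fun e ↦ hq (by simpa using e)
      rw [Function.update_of_ne hq]
      simp only [Fin.contractNth, Function.update_of_ne h1, Fin.val_castSucc]
      split_ifs with h2
      · rfl
      · rw [Function.update_of_ne]; intro e; have := congrArg Fin.val e; simp at this; omega
  · by_cases h' : (i : ℕ) = j + 1
    · refine ⟨j, LinearMap.mulLeft k (v j.castSucc), fun x ↦ ?_⟩
      have hi : i = j.succ := by ext; simp [h']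
      subst hi
      ext q
      by_cases hq : q = j
      · subst hq
        have : q.castSucc ≠ q.succ := by intro e; have := congrArg Fin.val e; simp at this
        simp [Fin.contractNth, Function.update_of_ne this]
      · have hq' : (q : ℕ) ≠ j := fun e ↦ hq (by ext; simp [e])
        have h1 : q.succ ≠ j.succ := fun e ↦ hq (by simpa using e)
        rw [Function.update_of_ne hq]
        simp only [Fin.contractNth, Function.update_of_ne h1, Fin.val_castSucc]
        split_ifs with h2
        · rw [Function.update_of_ne]; intro e; have := congrArg Fin.val e; simp at this; omega
        · rfl
    · refine ⟨⟨i - 1, by omega⟩, LinearMap.id, fun x ↦ ?_⟩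
      ext q
      by_cases hq : q = ⟨i - 1, by omega⟩
      · subst hq
        have h1 : (Fin.succ ⟨(i : ℕ) - 1, by omega⟩ : Fin (n + 1)) = i := by
          ext; simp; omega
        have h2 : ¬ ((i : ℕ) - 1 < j) := by omega
        have h3 : ¬ ((i : ℕ) - 1 = j) := by omega
        simp [Fin.contractNth, h1, h2, h3]
      · have hq' : (q : ℕ) ≠ i - 1 := fun e ↦ hq (by ext; simp [e])
        have h1 : q.succ ≠ i := by
          intro e; have := congrArg Fin.val e; simp at this; omega
        rw [Function.update_of_ne hq]
        simp only [Fin.contractNth, Function.update_of_ne h1, Fin.val_castSucc]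
        split_ifs with h2 h3
        · rw [Function.update_of_ne]; intro e; have := congrArg Fin.val e; simp at this; omega
        · rw [Function.update_of_ne]; intro e; have := congrArg Fin.val e; simp at this; omega
        · rfl

variable (k : Type u) (A : Type v) (M : Type w) [Field k] [Ring A] [Algebra k A]
  [AddCommGroup M] [Module k M] [Module A M] [Module Aᵐᵒᵖ M] [SMulCommClass A Aᵐᵒᵖ M]
  [IsScalarTower k A M] [IsScalarTower k Aᵐᵒᵖ M]

/-- Hochschild `n`-cochains: `k`-multilinear maps `A × ⋯ × A → M` in `n` variables. -/
abbrev Cochain (n : ℕ) : Type (max v w) := MultilinearMap k (fun _ : Fin n ↦ A) M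

/-- The Hochschild coboundary of a cochain,
`(df)(a₀, …, aₙ) = a₀ f(a₁, …, aₙ) + ∑_{j < n} (-1)^(j+1) f(a₀, …, aⱼ aⱼ₊₁, …, aₙ)
  + (-1)^(n+1) f(a₀, …, aₙ₋₁) aₙ`. -/
def coboundary {n : ℕ} (f : Cochain k A M n) : Cochain k A M (n + 1) where
  toFun a :=
    a 0 • f (Fin.tail a)
      + ∑ j : Fin n, (-1 : k) ^ ((j : ℕ) + 1) • f (Fin.contractNth j.castSucc (· * ·) a)
      + (-1 : k) ^ (n + 1) • (MulOpposite.op (a (Fin.last n)) • f (Fin.init a))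
  map_update_add' := by
    intro dec a i x y
    obtain rfl := Subsingleton.elim dec (instDecidableEqFin (n + 1))
    have h1 : ∀ j : Fin n, f (Fin.contractNth j.castSucc (· * ·) (Function.update a i (x + y))) =
        f (Fin.contractNth j.castSucc (· * ·) (Function.update a i x)) +
        f (Fin.contractNth j.castSucc (· * ·) (Function.update a i y)) := by
      intro j
      obtain ⟨p, L, h⟩ := contractNth_update (k := k) j a i
      simp only [h, map_add, MultilinearMap.map_update_add]
    have h2 : Function.update a i (x + y) 0 • f (Fin.tail (Function.update a i (x + y))) =
        Function.update a i x 0 • f (Fin.tail (Function.update a i x)) +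
        Function.update a i y 0 • f (Fin.tail (Function.update a i y)) := by
      refine Fin.cases ?_ (fun p ↦ ?_) i
      · simp [Fin.tail_update_zero, add_smul]
      · have : (0 : Fin (n + 1)) ≠ p.succ := (Fin.succ_ne_zero p).symm
        simp [Fin.tail_update_succ, Function.update_of_ne this]
    have h3 : MulOpposite.op (Function.update a i (x + y) (Fin.last n)) •
          f (Fin.init (Function.update a i (x + y))) =
        MulOpposite.op (Function.update a i x (Fin.last n)) •
          f (Fin.init (Function.update a i x)) +
        MulOpposite.op (Function.update a i y (Fin.last n)) •
          f (Fin.init (Function.update a i y)) := by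
      refine Fin.lastCases ?_ (fun p ↦ ?_) i
      · simp [Fin.init_update_last, add_smul]
      · have : Fin.last n ≠ p.castSucc := (Fin.castSucc_lt_last p).ne'
        simp [Fin.init_update_castSucc, Function.update_of_ne this]
    simp only [h1, h2, h3, smul_add, Finset.sum_add_distrib]
    abel
  map_update_smul' := by
    intro dec a i c x
    obtain rfl := Subsingleton.elim dec (instDecidableEqFin (n + 1))
    have h1 : ∀ j : Fin n, f (Fin.contractNth j.castSucc (· * ·) (Function.update a i (c • x))) =
        c • f (Fin.contractNth j.castSucc (· * ·) (Function.update a i x)) := by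
      intro j
      obtain ⟨p, L, h⟩ := contractNth_update (k := k) j a i
      simp only [h, map_smul, MultilinearMap.map_update_smul]
    have h2 : Function.update a i (c • x) 0 • f (Fin.tail (Function.update a i (c • x))) =
        c • (Function.update a i x 0 • f (Fin.tail (Function.update a i x))) := by
      refine Fin.cases ?_ (fun p ↦ ?_) i
      · simp [Fin.tail_update_zero]
      · have : (0 : Fin (n + 1)) ≠ p.succ := (Fin.succ_ne_zero p).symm
        simp [Fin.tail_update_succ, Function.update_of_ne this, smul_comm _ c]
    have h3 : MulOpposite.op (Function.update a i (c • x) (Fin.last n)) •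
          f (Fin.init (Function.update a i (c • x))) =
        c • (MulOpposite.op (Function.update a i x (Fin.last n)) •
          f (Fin.init (Function.update a i x))) := by
      refine Fin.lastCases ?_ (fun p ↦ ?_) i
      · simp [Fin.init_update_last]
      · have : Fin.last n ≠ p.castSucc := (Fin.castSucc_lt_last p).ne'
        simp [Fin.init_update_castSucc, Function.update_of_ne this, smul_comm _ c]
    simp only [h1, h2, h3, smul_add, Finset.smul_sum, smul_comm _ c]

/-- The Hochschild differential as a linear map. -/
def hochschildD (n : ℕ) : Cochain k A M n →ₗ[k] Cochain k A M (n + 1) where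
  toFun f := coboundary k A M f
  map_add' f g := by
    ext a
    simp [coboundary, Finset.sum_add_distrib]
    abel
  map_smul' c f := by
    ext a
    simp [coboundary, Finset.smul_sum, smul_comm _ c]

/-- The Hochschild `n`-coboundaries. -/
def coboundaries : (n : ℕ) → Submodule k (Cochain k A M n)
  | 0 => ⊥
  | n + 1 => LinearMap.range (hochschildD k A M n)

/-- The Hochschild `n`-cocycles. -/
def cocycles (n : ℕ) : Submodule k (Cochain k A M n) := LinearMap.ker (hochschildD k A M n)

/-- Hochschild cohomology `Hⁿ(A, M)`: cocycles modulo coboundaries. -/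
abbrev HochschildCohomology (n : ℕ) : Type (max v w) :=
  cocycles k A M n ⧸ (coboundaries k A M n).submoduleOf (cocycles k A M n)


/-- `[A, M]`, the `k`-subspace of `M` spanned by all `a m - m a`. -/
def commutatorSubspace : Submodule k M :=
  Submodule.span k {x | ∃ (a : A) (m : M), x = a • m - MulOpposite.op a • m}

/-- The subspace of `A ⊗[k] M` spanned by all `(c x b) ⊗ m - x ⊗ (b m c)`. -/
def envelopingRelations : Submodule k (A ⊗[k] M) :=
  Submodule.span k {t | ∃ (b c x : A) (m : M),
    t = (c * x * b) ⊗ₜ[k] m - x ⊗ₜ[k] (b • MulOpposite.op c • m)}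

/-- The tensor product `A ⊗_{Aᵉ} M` over the enveloping algebra `Aᵉ = A ⊗ Aᵒᵖ`: here `A` is a
right `Aᵉ`-module by `x · (b ⊗ c) = c x b` and `M` is a left one by `(b ⊗ c) · m = b m c`. -/
abbrev EnvelopingTensor : Type (max v w) := (A ⊗[k] M) ⧸ envelopingRelations k A M

end Hochschild

section Twist

/-- The twisted bimodule `^σ A^τ`: the space `A` with `a · m · b = σ(a) m τ(b)`. -/
def Twist {k : Type u} {A : Type v} [Field k] [Ring A] [Algebra k A] (_σ _τ : A ≃ₐ[k] A) :
    Type v := A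

variable {k : Type u} {A : Type v} [Field k] [Ring A] [Algebra k A] (σ τ : A ≃ₐ[k] A)

instance : AddCommGroup (Twist σ τ) := inferInstanceAs (AddCommGroup A)

instance : Module k (Twist σ τ) := inferInstanceAs (Module k A)

instance : Module A (Twist σ τ) := Module.compHom A (σ : A →+* A)

instance : Module Aᵐᵒᵖ (Twist σ τ) :=
  Module.compHom A (RingHom.op (τ : A →+* A))

/-- The identity map `A → ^σ A^τ`. -/
def Twist.of : A ≃ₗ[k] Twist σ τ := LinearEquiv.refl k A

theorem Twist.smul_of (a m : A) : a • Twist.of σ τ m = Twist.of σ τ (σ a * m) := rfl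

theorem Twist.op_smul_of (b m : A) :
    MulOpposite.op b • Twist.of σ τ m = Twist.of σ τ (m * τ b) := rfl

instance : SMulCommClass A Aᵐᵒᵖ (Twist σ τ) where
  smul_comm a b m := (mul_assoc (σ a) (m : A) (τ b.unop)).symm

instance : IsScalarTower k A (Twist σ τ) where
  smul_assoc c a m := by
    obtain ⟨m, rfl⟩ := (Twist.of σ τ).surjective m
    rw [Twist.smul_of, Twist.smul_of, map_smul, smul_mul_assoc, map_smul]

instance : IsScalarTower k Aᵐᵒᵖ (Twist σ τ) where
  smul_assoc c b m := by
    obtain ⟨m, rfl⟩ := (Twist.of σ τ).surjective m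
    obtain ⟨b, rfl⟩ := MulOpposite.op_surjective b
    rw [← MulOpposite.op_smul, Twist.op_smul_of, Twist.op_smul_of, map_smul, mul_smul_comm,
      map_smul]

end Twist

section CohomologicalDimension

variable (k : Type u) (A : Type v) [Field k] [Ring A] [Algebra k A]

/-- `Hcodim A = d`: the largest `i` with `Hⁱ(A, A) ≠ 0` is `d`. -/
def HcodimEq (d : ℕ) : Prop :=
  IsGreatest {i : ℕ | Nontrivial (HochschildCohomology k A A i)} d

/-- `THcodim A = d`: the largest `i` such that `Hⁱ(A, ^σ A) ≠ 0` for some algebra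
automorphism `σ` of `A` is `d`. -/
def THcodimEq (d : ℕ) : Prop :=
  IsGreatest {i : ℕ | ∃ σ : A ≃ₐ[k] A,
    Nontrivial (HochschildCohomology k A (Twist σ 1) i)} d

end CohomologicalDimension

section ArtinSchelter

open CategoryTheory Abelian

variable {k : Type u} {B : Type v} [Field k] [Ring B] [Algebra k B]

/-- The trivial left module `B / ker ε` of an algebra `B` with augmentation `ε`. -/
abbrev trivialModule (ε : B →ₐ[k] k) : ModuleCat.{v} B := ModuleCat.of B (B ⧸ RingHom.ker ε)

/-- The left module `_B B`. -/
abbrev regularModule (B : Type v) [Ring B] : ModuleCat.{v} B := ModuleCat.of B B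

/-- The left global dimension of a ring. -/
noncomputable def globalDimension (B : Type v) [Ring B] : WithBot ℕ∞ :=
  ⨆ M : ModuleCat.{v} B, projectiveDimension M

/-- The one-sided Artin-Schelter conditions for an augmented algebra, for left modules: the
injective dimension of `_B B` is `d`, the space `Ext^d(k, B)` is one-dimensional and
`Ext^i(k, B) = 0` for `i ≠ d`. -/
structure IsLeftASGorenstein (ε : B →ₐ[k] k) (d : ℕ) : Prop where
  injectiveDimension_eq : injectiveDimension (regularModule B) = d
  finrank_ext : Module.finrank k (Ext (trivialModule ε) (regularModule B) d) = 1
  subsingleton_ext : ∀ i : ℕ, i ≠ d → Subsingleton (Ext (trivialModule ε) (regularModule B) i)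

/-- The augmentation of the opposite algebra given by an augmentation of the algebra. -/
def opAugmentation (ε : B →ₐ[k] k) : Bᵐᵒᵖ →ₐ[k] k :=
  ε.fromOpposite fun _ _ ↦ Commute.all _ _

/-- An augmented algebra is Artin-Schelter Gorenstein of dimension `d` if the conditions above
hold for left modules and for right modules (that is, left modules over the opposite algebra). -/
structure IsASGorenstein (ε : B →ₐ[k] k) (d : ℕ) : Prop where
  left : IsLeftASGorenstein ε d
  right : IsLeftASGorenstein (opAugmentation ε) d

/-- An augmented algebra is Artin-Schelter regular of dimension `d` if it is Artin-Schelter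
Gorenstein of dimension `d` and has global dimension `d`. -/
structure IsASRegular (ε : B →ₐ[k] k) (d : ℕ) : Prop extends IsASGorenstein ε d where
  globalDimension_eq : globalDimension B = d

/-- Right multiplication by `b` as an endomorphism of the left module `_B B`. -/
def rightMul (b : B) : regularModule B ⟶ regularModule B :=
  ModuleCat.ofHom (LinearMap.toSpanSingleton B B b)

/-- The left homological integral `Ext^d(_B k, _B B)`. -/
abbrev LeftIntegral (ε : B →ₐ[k] k) (d : ℕ) : Type v :=
  Ext (trivialModule ε) (regularModule B) d

/-- The right action of `B` on `Ext^d(_B k, _B B)` that comes from the right multiplication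
of `B` on `B`. -/
noncomputable def LeftIntegral.rightAct {ε : B →ₐ[k] k} {d : ℕ} (e : LeftIntegral ε d) (b : B) :
    LeftIntegral ε d :=
  e.comp (Ext.mk₀ (rightMul b)) (add_zero d)

theorem LeftIntegral.rightAct_mul {ε : B →ₐ[k] k} {d : ℕ} (e : LeftIntegral ε d) (b c : B) :
    e.rightAct (b * c) = (e.rightAct b).rightAct c := by
  have : rightMul (b * c) = rightMul b ≫ rightMul c := by
    ext; simp [rightMul]
  simp only [LeftIntegral.rightAct, this]
  rw [Ext.comp_assoc_of_second_deg_zero, Ext.mk₀_comp_mk₀]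

/-- `B` acts on the right on its (one-dimensional) left integral through a character. -/
theorem exists_character {ε : B →ₐ[k] k} {d : ℕ} (h : IsLeftASGorenstein ε d) :
    ∃ π : B →ₐ[k] k, ∀ (b : B) (e : LeftIntegral ε d), e.rightAct b = π b • e := by
  have h1 : ∀ b : B, ∃ c : k, ∀ e : LeftIntegral ε d, e.rightAct b = c • e := by
    intro b
    obtain ⟨c, hc, -⟩ := LinearMap.existsUnique_eq_smul_id_of_finrank_eq_one h.finrank_ext
      ((Ext.mk₀ (rightMul b)).postcompOfLinear k (trivialModule ε) (add_zero d))
    exact ⟨c, fun e ↦ congr($hc e)⟩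
  choose c hc using h1
  have : Nontrivial (LeftIntegral ε d) :=
    Module.nontrivial_of_finrank_pos (R := k) (by rw [h.finrank_ext]; exact one_pos)
  obtain ⟨e, he⟩ := exists_ne (0 : LeftIntegral ε d)
  have inj : ∀ x y : k, x • e = y • e → x = y := fun x y hxy ↦ smul_left_injective k he hxy
  have hadd : ∀ a b : B, rightMul (a + b) = rightMul a + rightMul b := by
    intro a b; ext; simp [rightMul]
  have hsmul : ∀ (r : k) (b : B) (e : LeftIntegral ε d),
      e.rightAct (r • b) = r • e.rightAct b := by
    intro r b e
    have h2 : r • b = b * (r • (1 : B)) := by simp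
    rw [h2, LeftIntegral.rightAct_mul, Ext.smul_eq_comp_mk₀]
    refine congrArg (fun f ↦ Ext.comp (e.rightAct b) (Ext.mk₀ f) (add_zero d)) ?_
    apply ModuleCat.hom_ext
    apply LinearMap.ext
    intro (x : B)
    change x * (r • (1 : B)) = algebraMap k B r * x
    rw [mul_smul_one, Algebra.smul_def]
  refine ⟨AlgHom.ofLinearMap ⟨⟨c, fun a b ↦ inj _ _ ?_⟩, fun r b ↦ inj _ _ ?_⟩ (inj _ _ ?_)
    fun a b ↦ inj _ _ ?_, fun b e ↦ hc b e⟩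
  · rw [add_smul, ← hc, ← hc, ← hc]
    simp only [LeftIntegral.rightAct, hadd, Ext.mk₀_add, Ext.comp_add]
  · rw [← hc, RingHom.id_apply, smul_eq_mul, mul_smul, ← hc, hsmul]
  · change c 1 • e = (1 : k) • e
    rw [← hc, one_smul]
    have : rightMul (1 : B) = 𝟙 _ := by ext; simp [rightMul]
    simp only [LeftIntegral.rightAct, this, Ext.comp_mk₀_id]
  · change c (a * b) • e = (c a * c b) • e
    rw [← hc, LeftIntegral.rightAct_mul, hc, hc, smul_smul, mul_comm]

/-- The character `π₀ : B → k` by which `B` acts on the right on its left integral, i.e. the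
canonical map `B → B / r.ann (∫ˡ) = k`. -/
noncomputable def integralCharacter {ε : B →ₐ[k] k} {d : ℕ} (h : IsLeftASGorenstein ε d) :
    B →ₐ[k] k :=
  (exists_character h).choose

theorem rightAct_eq_integralCharacter_smul {ε : B →ₐ[k] k} {d : ℕ}
    (h : IsLeftASGorenstein ε d) (b : B) (e : LeftIntegral ε d) :
    e.rightAct b = integralCharacter h b • e :=
  (exists_character h).choose_spec b e

end ArtinSchelter

section Winding

open Coalgebra HopfAlgebra

variable {k : Type u} {A : Type v} [Field k] [Ring A] [HopfAlgebra k A]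

/-- The left winding endomorphism `Ξ[π] : a ↦ ∑ π(a₁) a₂` of a character `π`. -/
noncomputable def windingHom (π : A →ₐ[k] k) : A →ₐ[k] A :=
  (Algebra.TensorProduct.lid k A).toAlgHom.comp
    ((Algebra.TensorProduct.map π (AlgHom.id k A)).comp (Bialgebra.comulAlgHom k A))

/-- The composite `π ∘ S` of a character with the antipode, again a character. -/
noncomputable def characterInv (π : A →ₐ[k] k) : A →ₐ[k] k :=
  AlgHom.ofLinearMap (π.toLinearMap ∘ₗ antipode k) (by simp)
    (fun a b ↦ by simp [antipode_mul_antidistrib, mul_comm])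

theorem characterInv_apply (π : A →ₐ[k] k) (a : A) :
    characterInv π a = π (antipode k a) := rfl

theorem windingHom_comp_eq_id {p q : A →ₐ[k] k}
    (h : LinearMap.mul' k k ∘ₗ TensorProduct.map q.toLinearMap p.toLinearMap ∘ₗ comul =
      counit (R := k) (A := A)) :
    (windingHom p).comp (windingHom q) = AlgHom.id k A := by
  let G : A ⊗[k] (A ⊗[k] A) →ₗ[k] A :=
    (TensorProduct.lid k A).toLinearMap ∘ₗ TensorProduct.map q.toLinearMap
      ((TensorProduct.lid k A).toLinearMap ∘ₗ TensorProduct.map p.toLinearMap LinearMap.id)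
  have h1 : (windingHom p).toLinearMap ∘ₗ (TensorProduct.lid k A).toLinearMap ∘ₗ
      TensorProduct.map q.toLinearMap LinearMap.id = G ∘ₗ comul.lTensor A := by
    ext a b
    simp [G, windingHom]
    rfl
  have h2 : G ∘ₗ (TensorProduct.assoc k A A A).toLinearMap =
      (TensorProduct.lid k A).toLinearMap ∘ₗ
      (LinearMap.mul' k k ∘ₗ TensorProduct.map q.toLinearMap p.toLinearMap).rTensor A := by
    ext a b c
    simpa [G, mul_smul] using smul_comm _ _ _
  ext a
  have e1 := LinearMap.congr_fun h1 (comul a)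
  have e2 := LinearMap.congr_fun h2 ((comul (R := k)).rTensor A (comul a))
  have e3 : ((LinearMap.mul' k k ∘ₗ TensorProduct.map q.toLinearMap p.toLinearMap).rTensor A)
      ((comul (R := k)).rTensor A (comul a)) = (counit (R := k)).rTensor A (comul a) := by
    rw [← LinearMap.comp_apply, ← LinearMap.rTensor_comp, LinearMap.comp_assoc, h]
  simp only [LinearMap.comp_apply, e3, LinearEquiv.coe_coe, coassoc_apply,
    rTensor_counit_comul] at e1 e2
  simp only [TensorProduct.lid_tmul, one_smul] at e2
  exact e1.trans e2

theorem windingHom_characterInv_left (π : A →ₐ[k] k) :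
    (windingHom (characterInv π)).comp (windingHom π) = AlgHom.id k A := by
  apply windingHom_comp_eq_id
  have h : LinearMap.mul' k k ∘ₗ
      TensorProduct.map π.toLinearMap (characterInv π).toLinearMap =
      π.toLinearMap ∘ₗ LinearMap.mul' k A ∘ₗ (antipode k).lTensor A := by
    ext a b
    simp [characterInv_apply]
  ext a
  rw [← LinearMap.comp_assoc, h]
  simp

theorem windingHom_characterInv_right (π : A →ₐ[k] k) :
    (windingHom π).comp (windingHom (characterInv π)) = AlgHom.id k A := by
  apply windingHom_comp_eq_id
  have h : LinearMap.mul' k k ∘ₗ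
      TensorProduct.map (characterInv π).toLinearMap π.toLinearMap =
      π.toLinearMap ∘ₗ LinearMap.mul' k A ∘ₗ (antipode k).rTensor A := by
    ext a b
    simp [characterInv_apply]
  ext a
  rw [← LinearMap.comp_assoc, h]
  simp

/-- The left winding automorphism `Ξ[π] : a ↦ ∑ π(a₁) a₂` of a character `π`. -/
noncomputable def winding (π : A →ₐ[k] k) : A ≃ₐ[k] A :=
  AlgEquiv.ofAlgHom (windingHom π) (windingHom (characterInv π))
    (windingHom_characterInv_right π) (windingHom_characterInv_left π)

/-- The square `S²` of a bijective antipode as an algebra automorphism. -/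
noncomputable def antipodeSq (hS : Function.Bijective (antipode k : A →ₗ[k] A)) : A ≃ₐ[k] A :=
  AlgEquiv.ofBijective
    (AlgHom.ofLinearMap (antipode k ∘ₗ antipode k) (by simp)
      (fun a b ↦ by simp [antipode_mul_antidistrib]))
    (hS.comp hS)

/-- The automorphism `ν = ξ S²` of a Hopf algebra with bijective antipode that satisfies the left
Artin-Schelter conditions, where `ξ = Ξ[π₀]` is the left winding automorphism of the character
`π₀` of the left integral. -/
noncomputable def nu {d : ℕ} (h : IsLeftASGorenstein (Bialgebra.counitAlgHom k A) d)
    (hS : Function.Bijective (antipode k : A →ₗ[k] A)) : A ≃ₐ[k] A :=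
  winding (integralCharacter h) * antipodeSq hS

end Winding

end HopfDuality

/-! Over a Hopf algebra Hochschild cohomology is one-sided: Hⁿ(A, M) is Extⁿ(k, M) for the adjoint
action a · m = ∑ a₁ m S(a₂) on M (`nonempty_hochschildCohomology_equiv_ext`). Both theories are
shifted in degree along the same embedding of M in the coinduced bimodule Hom_k(A, M). Its positive
Hochschild cohomology vanishes (`Coind.cocycles_le_coboundaries`), and its adjoint module is
injective (`Adj.injective_adj_coind`). In degree zero both theories give the m with a m = m a for
all a.

Global dimension d makes Ext^d(k, -) right exact, and noetherianity lets every class come from a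
finitely generated module. So a generator e of Ext^d(k, A) induces a surjection N → Ext^d(k, N), n ↦
e n. Its kernel is spanned by the b n - π₀(b) n (`ker_pushClass`).

For N = M with the adjoint action, a convolution computation (`span_twisted_commutators`) turns this
kernel into the span of the a m - m ν(a), where ν = ξ S². Hence H^d(A, M) is M modulo these
elements, for every bimodule M. The rest is the choice of M: applying ν⁻¹ to ^σ A gives (a). For σ =
ν the quotient is A/[A, A], nonzero because the counit kills commutators. Taking M = A gives (c).
Above d all cohomology vanishes. -/

set_option linter.unusedSectionVars false

namespace HopfDuality

/-! ### Functoriality of Hochschild cochains in the bimodule -/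

section BimoduleHom

variable {k : Type u} {A : Type v} {M N : Type*} [Field k] [Ring A] [Algebra k A]
  [AddCommGroup M] [Module k M] [Module A M] [Module Aᵐᵒᵖ M] [SMulCommClass A Aᵐᵒᵖ M]
  [IsScalarTower k A M] [IsScalarTower k Aᵐᵒᵖ M]
  [AddCommGroup N] [Module k N] [Module A N] [Module Aᵐᵒᵖ N] [SMulCommClass A Aᵐᵒᵖ N]
  [IsScalarTower k A N] [IsScalarTower k Aᵐᵒᵖ N]

/-- A linear map between bimodules that commutes with both actions. -/
structure IsBimoduleHom (A : Type v) [Ring A] [Module A M] [Module Aᵐᵒᵖ M] [Module A N]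
    [Module Aᵐᵒᵖ N] (φ : M →ₗ[k] N) : Prop where
  map_smul : ∀ (a : A) (m : M), φ (a • m) = a • φ m
  map_op_smul : ∀ (a : A) (m : M), φ (MulOpposite.op a • m) = MulOpposite.op a • φ m

/-- Postcomposition of a cochain with a linear map. -/
def Cochain.map (A : Type v) [Ring A] [Algebra k A] (φ : M →ₗ[k] N) (n : ℕ) :
    Cochain k A M n →ₗ[k] Cochain k A N n where
  toFun f := φ.compMultilinearMap f
  map_add' f g := by ext; simp
  map_smul' c f := by ext; simp

@[simp]
theorem Cochain.map_apply (φ : M →ₗ[k] N) {n : ℕ} (f : Cochain k A M n) (a : Fin n → A) :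
    Cochain.map A φ n f a = φ (f a) := rfl

theorem hochschildD_apply {n : ℕ} (f : Cochain k A M n) (a : Fin (n + 1) → A) :
    hochschildD k A M n f a = a 0 • f (Fin.tail a)
      + ∑ j : Fin n, (-1 : k) ^ ((j : ℕ) + 1) • f (Fin.contractNth j.castSucc (· * ·) a)
      + (-1 : k) ^ (n + 1) • (MulOpposite.op (a (Fin.last n)) • f (Fin.init a)) := rfl

theorem IsBimoduleHom.hochschildD_map {φ : M →ₗ[k] N} (hφ : IsBimoduleHom A φ) {n : ℕ}
    (f : Cochain k A M n) :
    hochschildD k A N n (Cochain.map A φ n f) =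
      Cochain.map A φ (n + 1) (hochschildD k A M n f) := by
  ext a
  simp [hochschildD_apply, hφ.map_smul, hφ.map_op_smul]

theorem IsBimoduleHom.map_mem_cocycles {φ : M →ₗ[k] N} (hφ : IsBimoduleHom A φ) {n : ℕ}
    {f : Cochain k A M n} (hf : f ∈ cocycles k A M n) :
    Cochain.map A φ n f ∈ cocycles k A N n := by
  rw [cocycles, LinearMap.mem_ker] at hf ⊢
  rw [hφ.hochschildD_map, hf, map_zero]

end BimoduleHom

/-! ### Coinduced bimodules and their contracting homotopy -/

section Coind

variable (k : Type u) (A : Type v) (M : Type w) [Field k] [Ring A] [Algebra k A]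
  [AddCommGroup M] [Module k M] [Module A M] [Module Aᵐᵒᵖ M] [SMulCommClass A Aᵐᵒᵖ M]
  [IsScalarTower k A M] [IsScalarTower k Aᵐᵒᵖ M]

/-- The bimodule of linear maps `φ : A → M` with `(a φ)(b) = φ(b a)` and `(φ a)(b) = φ(b) a`. -/
def Coind : Type (max v w) := A →ₗ[k] M

namespace Coind

instance : AddCommGroup (Coind k A M) := inferInstanceAs (AddCommGroup (A →ₗ[k] M))
instance : Module k (Coind k A M) := inferInstanceAs (Module k (A →ₗ[k] M))
instance : FunLike (Coind k A M) A M := inferInstanceAs (FunLike (A →ₗ[k] M) A M)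
instance : LinearMapClass (Coind k A M) k A M :=
  inferInstanceAs (LinearMapClass (A →ₗ[k] M) k A M)

variable {k A M}

@[ext]
theorem ext {φ ψ : Coind k A M} (h : ∀ b, φ b = ψ b) : φ = ψ := DFunLike.ext _ _ h

@[simp] theorem add_apply (φ ψ : Coind k A M) (b : A) : (φ + ψ) b = φ b + ψ b := rfl
@[simp] theorem sub_apply (φ ψ : Coind k A M) (b : A) : (φ - ψ) b = φ b - ψ b := rfl
@[simp] theorem neg_apply (φ : Coind k A M) (b : A) : (-φ) b = -φ b := rfl
@[simp] theorem zero_apply (b : A) : (0 : Coind k A M) b = 0 := rfl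
@[simp] theorem smul_apply (c : k) (φ : Coind k A M) (b : A) : (c • φ) b = c • φ b := rfl

@[simp] theorem sum_apply {ι : Type*} (s : Finset ι) (φ : ι → Coind k A M) (b : A) :
    (∑ i ∈ s, φ i) b = ∑ i ∈ s, φ i b :=
  LinearMap.sum_apply s φ b

instance : SMul A (Coind k A M) :=
  ⟨fun a φ ↦ (show A →ₗ[k] M from φ) ∘ₗ LinearMap.mulRight k a⟩

instance : SMul Aᵐᵒᵖ (Coind k A M) :=
  ⟨fun a φ ↦ Module.toModuleEnd k M a ∘ₗ (show A →ₗ[k] M from φ)⟩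

@[simp] theorem left_smul_apply (a : A) (φ : Coind k A M) (b : A) : (a • φ) b = φ (b * a) := rfl
@[simp] theorem right_smul_apply (a : Aᵐᵒᵖ) (φ : Coind k A M) (b : A) : (a • φ) b = a • φ b := rfl

instance : Module A (Coind k A M) where
  one_smul φ := by ext; simp
  mul_smul a b φ := by ext; simp [mul_assoc]
  smul_zero a := by ext; simp
  zero_smul φ := by ext; simp
  smul_add a φ ψ := by ext; simp
  add_smul a b φ := by ext; simp [mul_add]

instance : Module Aᵐᵒᵖ (Coind k A M) where
  one_smul φ := by ext; simp
  mul_smul a b φ := by ext; simp [mul_smul]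
  smul_zero a := by ext; simp
  zero_smul φ := by ext; simp
  smul_add a φ ψ := by ext; simp
  add_smul a b φ := by ext; simp [add_smul]

instance : SMulCommClass A Aᵐᵒᵖ (Coind k A M) where
  smul_comm a b φ := by ext; simp

instance : IsScalarTower k A (Coind k A M) where
  smul_assoc c a φ := by ext; simp

instance : IsScalarTower k Aᵐᵒᵖ (Coind k A M) where
  smul_assoc c a φ := by ext; simp

variable (k A M) in
/-- The bimodule embedding `M → Coind M`, `m ↦ (b ↦ b m)`. -/
def incl : M →ₗ[k] Coind k A M where
  toFun m := (LinearMap.toSpanSingleton A M m).restrictScalars k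
  map_add' m n := by ext b; exact smul_add b m n
  map_smul' c m := by ext b; exact smul_comm b c m

@[simp] theorem incl_apply (m : M) (b : A) : incl k A M m b = b • m := rfl

theorem isBimoduleHom_incl : IsBimoduleHom A (incl k A M) where
  map_smul a m := by ext; simp [mul_smul]
  map_op_smul a m := by ext; simp [smul_comm]

variable (k A M) in
/-- Evaluation at `1`. -/
def evalOne : Coind k A M →ₗ[k] M where
  toFun φ := φ 1
  map_add' _ _ := rfl
  map_smul' _ _ := rfl

@[simp] theorem evalOne_apply (φ : Coind k A M) : evalOne k A M φ = φ 1 := rfl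

/-- The contracting homotopy `(sf)(a₁, …, aₙ)(b) = f(b, a₁, …, aₙ)(1)`. -/
def contraction {n : ℕ} (f : Cochain k A (Coind k A M) (n + 1)) :
    Cochain k A (Coind k A M) n where
  toFun a :=
    { toFun b := f (Fin.cons b a) 1
      map_add' b c := by rw [MultilinearMap.cons_add, add_apply]
      map_smul' r b := by rw [MultilinearMap.cons_smul, smul_apply, RingHom.id_apply] }
  map_update_add' a i x y := by
    obtain rfl := Subsingleton.elim ‹DecidableEq (Fin n)› (instDecidableEqFin n)
    ext b
    change f (Fin.cons b _) 1 = f (Fin.cons b _) 1 + f (Fin.cons b _) 1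
    have h := Fin.cons_update (α := fun _ ↦ A) b a i
    rw [h, h, h, MultilinearMap.map_update_add, add_apply]
  map_update_smul' a i c x := by
    obtain rfl := Subsingleton.elim ‹DecidableEq (Fin n)› (instDecidableEqFin n)
    ext b
    change f (Fin.cons b _) 1 = c • f (Fin.cons b _) 1
    have h := Fin.cons_update (α := fun _ ↦ A) b a i
    rw [h, h, MultilinearMap.map_update_smul, smul_apply]

@[simp]
theorem contraction_apply {n : ℕ} (f : Cochain k A (Coind k A M) (n + 1)) (a : Fin n → A)
    (b : A) : contraction f a b = f (Fin.cons b a) 1 := rfl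

theorem contractNth_cons_zero {n : ℕ} (b : A) (a : Fin (n + 1) → A) :
    Fin.contractNth 0 (· * ·) (Fin.cons b a : Fin (n + 2) → A) =
      Fin.cons (b * a 0) (Fin.tail a) := by
  ext i
  refine Fin.cases ?_ (fun i ↦ ?_) i <;> simp [Fin.contractNth, Fin.tail]

theorem contractNth_cons_succ {n : ℕ} (b : A) (a : Fin (n + 1) → A) (j : Fin n) :
    Fin.contractNth j.succ.castSucc (· * ·) (Fin.cons b a : Fin (n + 2) → A) =
      Fin.cons b (Fin.contractNth j.castSucc (· * ·) a) := by
  ext i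
  refine Fin.cases ?_ (fun i ↦ ?_) i
  · simp [Fin.contractNth]
  · simp [Fin.contractNth]

theorem init_cons {n : ℕ} (b : A) (a : Fin (n + 1) → A) :
    Fin.init (Fin.cons b a : Fin (n + 2) → A) = Fin.cons b (Fin.init a) := by
  ext i
  refine Fin.cases ?_ (fun i ↦ ?_) i
  · simp [Fin.init]
  · simp [Fin.init]

/-- The leading term of df, evaluated at (b, a) and then at 1, is f(a)(1 · b) = f(a)(b). Every other
term reappears in d(sf) with the opposite sign; in particular f(b a₀, …)(1) is the leading term
there. -/
theorem contraction_hochschildD_add {n : ℕ} (f : Cochain k A (Coind k A M) (n + 1)) :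
    contraction (hochschildD k A _ (n + 1) f) + hochschildD k A _ n (contraction f) = f := by
  ext a b
  simp only [_root_.add_apply, add_apply, neg_apply, contraction_apply, hochschildD_apply,
    left_smul_apply, sum_apply, smul_apply, right_smul_apply, Fin.sum_univ_succ, Fin.castSucc_zero,
    contractNth_cons_zero, contractNth_cons_succ, init_cons, Fin.tail_cons, Fin.cons_zero, one_mul,
    ← Fin.succ_last, Fin.cons_succ, Fin.val_zero, Fin.val_succ, pow_succ, pow_zero, mul_neg,
    mul_one, neg_neg, neg_smul, one_smul, Finset.sum_neg_distrib]
  abel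

/-- The homotopy gives f = d(sf) for a cocycle f. It consumes one variable, hence the restriction to
positive degree. -/
theorem cocycles_le_coboundaries (n : ℕ) :
    cocycles k A (Coind k A M) (n + 1) ≤ coboundaries k A (Coind k A M) (n + 1) := by
  intro f hf
  refine ⟨contraction f, ?_⟩
  have h := contraction_hochschildD_add f
  rw [show hochschildD k A _ (n + 1) f = 0 from hf] at h
  have h0 : contraction (0 : Cochain k A (Coind k A M) (n + 2)) = 0 := by ext; simp
  rwa [h0, zero_add] at h

end Coind

end Coind

/-! ### Dimension shifting for Hochschild cohomology -/

section Shift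

variable {k : Type u} {A : Type v} {M : Type v} [Field k] [Ring A] [Algebra k A]
  [AddCommGroup M] [Module k M] [Module A M] [Module Aᵐᵒᵖ M] [SMulCommClass A Aᵐᵒᵖ M]
  [IsScalarTower k A M] [IsScalarTower k Aᵐᵒᵖ M]

-- The homotopy replaces the usual sign bookkeeping. With coinduced coefficients, applying d to f =
-- sdf + dsf and using d² = 0 one degree lower gives df = dsdf, while the homotopy at df says df =
-- sddf + dsdf; so sddf = 0. Evaluating this for a cochain embedded by `incl` gives ddf = 0 for
-- arbitrary coefficients.
open Coind in
theorem hochschildD_comp_self (n : ℕ) (f : Cochain k A M n) :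
    hochschildD k A M (n + 1) (hochschildD k A M n f) = 0 := by
  induction n generalizing M with
  | zero =>
    ext a
    have h0 : ∀ x : Fin 0 → A, f x = f 0 := fun x ↦ congrArg f (Subsingleton.elim _ _)
    simp [hochschildD_apply, h0, Fin.contractNth, Fin.tail, Fin.init, smul_smul]
    rw [← smul_comm (a 0) (MulOpposite.op (a 1))]
    abel
  | succ n ih =>
    have key : ∀ g : Cochain k A (Coind k A M) (n + 1),
        contraction (hochschildD k A _ (n + 2) (hochschildD k A _ (n + 1) g)) = 0 := by
      intro g
      have h1 := contraction_hochschildD_add g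
      have h2 := contraction_hochschildD_add (hochschildD k A _ (n + 1) g)
      have h3 := congrArg (hochschildD k A _ (n + 1)) h1
      rw [map_add, ih, add_zero] at h3
      rw [h3] at h2
      exact add_eq_right.1 h2
    have h := key (Cochain.map A (incl k A M) _ f)
    rw [isBimoduleHom_incl.hochschildD_map, isBimoduleHom_incl.hochschildD_map] at h
    ext a
    have := congr($h (Fin.tail a) (a 0))
    simpa using this

variable (k A M) in
/-- The cokernel of `Coind.incl`, realized as the space of linear maps `φ : A → M` with `φ 1 = 0`
and the actions `(a φ)(b) = φ(b a) - b φ(a)` and `(φ a)(b) = φ(b) a`. -/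
def CoindQuot : Type v := LinearMap.ker (Coind.evalOne k A M)

namespace CoindQuot

instance : AddCommGroup (CoindQuot k A M) :=
  inferInstanceAs (AddCommGroup (LinearMap.ker (Coind.evalOne k A M)))
instance : Module k (CoindQuot k A M) :=
  inferInstanceAs (Module k (LinearMap.ker (Coind.evalOne k A M)))

variable (k A M) in
/-- The inclusion of `CoindQuot` in `Coind`, which is linear over `k` only. -/
def lift : CoindQuot k A M →ₗ[k] Coind k A M := (LinearMap.ker (Coind.evalOne k A M)).subtype

variable (k A M) in
/-- The projection `φ ↦ φ - (b ↦ b φ(1))`. -/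
def proj : Coind k A M →ₗ[k] CoindQuot k A M :=
  LinearMap.codRestrict _ (LinearMap.id - Coind.incl k A M ∘ₗ Coind.evalOne k A M)
    fun φ ↦ by simp

theorem lift_proj (φ : Coind k A M) :
    lift k A M (proj k A M φ) = φ - Coind.incl k A M (φ 1) := rfl

@[simp] theorem lift_apply_one (φ : CoindQuot k A M) : lift k A M φ 1 = 0 := φ.2

theorem lift_injective : Function.Injective (lift k A M) := Subtype.val_injective

@[simp] theorem proj_lift (φ : CoindQuot k A M) : proj k A M (lift k A M φ) = φ :=
  lift_injective (by simp [lift_proj])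

@[simp] theorem proj_incl (m : M) : proj k A M (Coind.incl k A M m) = 0 :=
  lift_injective (by simp [lift_proj])

instance : SMul A (CoindQuot k A M) := ⟨fun a φ ↦ proj k A M (a • lift k A M φ)⟩
instance : SMul Aᵐᵒᵖ (CoindQuot k A M) := ⟨fun a φ ↦ proj k A M (a • lift k A M φ)⟩

/-- The lift is not left linear: φ(1) = 0 does not survive, as (a φ)(1) = φ(a), and `proj` subtracts
exactly this defect. -/
theorem lift_smul (a : A) (φ : CoindQuot k A M) :
    lift k A M (a • φ) = a • lift k A M φ - Coind.incl k A M (lift k A M φ a) := by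
  refine (lift_proj _).trans ?_
  simp

theorem lift_op_smul (a : Aᵐᵒᵖ) (φ : CoindQuot k A M) :
    lift k A M (a • φ) = a • lift k A M φ := by
  refine (lift_proj _).trans ?_
  simp

instance : Module A (CoindQuot k A M) where
  one_smul φ := lift_injective (by simp [lift_smul])
  mul_smul a b φ := lift_injective (by ext; simp [lift_smul, mul_assoc, mul_smul, smul_sub])
  smul_zero a := lift_injective (by simp [lift_smul])
  zero_smul φ := lift_injective (by simp [lift_smul])
  smul_add a φ ψ := lift_injective (by simp [lift_smul]; abel)
  add_smul a b φ := lift_injective (by simp [lift_smul, add_smul]; abel)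

instance : Module Aᵐᵒᵖ (CoindQuot k A M) where
  one_smul φ := lift_injective (by simp [lift_op_smul])
  mul_smul a b φ := lift_injective (by simp [lift_op_smul, mul_smul])
  smul_zero a := lift_injective (by simp [lift_op_smul])
  zero_smul φ := lift_injective (by simp [lift_op_smul])
  smul_add a φ ψ := lift_injective (by simp [lift_op_smul])
  add_smul a b φ := lift_injective (by simp [lift_op_smul, add_smul])

instance : SMulCommClass A Aᵐᵒᵖ (CoindQuot k A M) where
  smul_comm a b φ := lift_injective (by ext; simp [lift_smul, lift_op_smul, smul_sub, smul_comm])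

instance : IsScalarTower k A (CoindQuot k A M) where
  smul_assoc c a φ := lift_injective (by simp [lift_smul, smul_sub])

instance : IsScalarTower k Aᵐᵒᵖ (CoindQuot k A M) where
  smul_assoc c a φ := lift_injective (by simp [lift_op_smul])

theorem isBimoduleHom_proj : IsBimoduleHom A (proj k A M) where
  map_smul a φ := lift_injective (by
    ext; simp [lift_smul, lift_proj, smul_sub, mul_smul])
  map_op_smul a φ := lift_injective (by
    ext; simp [lift_op_smul, lift_proj, smul_sub, smul_comm])

theorem incl_add_lift_proj (φ : Coind k A M) :
    Coind.incl k A M (Coind.evalOne k A M φ) + lift k A M (proj k A M φ) = φ := by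
  simp [lift_proj]

end CoindQuot

open Coind CoindQuot

/-- Pointwise exactness at `Coind`, with `evalOne` as a k-linear retraction of `incl`. -/
theorem map_incl_evalOne {n : ℕ} (f : Cochain k A (Coind k A M) n)
    (hf : Cochain.map A (proj k A M) n f = 0) :
    Cochain.map A (incl k A M) n (Cochain.map A (evalOne k A M) n f) = f := by
  refine MultilinearMap.ext fun a ↦ ?_
  have h := incl_add_lift_proj (f a)
  rwa [show proj k A M (f a) = 0 from congr($hf a), map_zero, add_zero] at h

theorem map_proj_hochschildD_lift {n : ℕ} {q : Cochain k A (CoindQuot k A M) n}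
    (hq : q ∈ cocycles k A _ n) :
    Cochain.map A (proj k A M) _ (hochschildD k A _ n (Cochain.map A (lift k A M) n q)) = 0 := by
  have h : Cochain.map A (proj k A M) n (Cochain.map A (lift k A M) n q) = q := by ext a; simp
  rw [← isBimoduleHom_proj.hochschildD_map, h]
  exact hq

variable (k A M) in
/-- The connecting map of `0 → M → Coind M → CoindQuot M → 0` on cocycles. -/
def connecting (n : ℕ) : cocycles k A (CoindQuot k A M) n →ₗ[k] cocycles k A M (n + 1) :=
  LinearMap.codRestrict _ (Cochain.map A (evalOne k A M) (n + 1) ∘ₗ hochschildD k A _ n ∘ₗ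
    Cochain.map A (lift k A M) n ∘ₗ (cocycles k A (CoindQuot k A M) n).subtype) fun q ↦ by
  -- The differential of the lift takes values in the image of `incl`; as `incl` is equivariant with
  -- retraction `evalOne`, d² = 0 descends to the M-valued cochain.
  have h := map_incl_evalOne _ (map_proj_hochschildD_lift q.2)
  have h2 := congrArg (hochschildD k A _ (n + 1)) h
  rw [hochschildD_comp_self, isBimoduleHom_incl.hochschildD_map] at h2
  have h3 := congrArg (Cochain.map A (evalOne k A M) _) h2
  refine MultilinearMap.ext fun a ↦ ?_
  have h4 := congr($h3 a)
  simpa using h4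

theorem map_incl_connecting {n : ℕ} (q : cocycles k A (CoindQuot k A M) n) :
    Cochain.map A (incl k A M) (n + 1) (connecting k A M n q : Cochain k A M (n + 1)) =
      hochschildD k A _ n (Cochain.map A (lift k A M) n q) :=
  map_incl_evalOne _ (map_proj_hochschildD_lift q.2)

theorem map_incl_injective (n : ℕ) : Function.Injective (Cochain.map A (incl k A M) n) := by
  intro f g h
  ext a
  have := congr(evalOne k A M ($h a))
  simpa using this

variable (k A M) in
/-- The cocycles with values in `CoindQuot` that lift to cocycles with values in `Coind`. -/
def liftableCocycles (n : ℕ) : Submodule k (cocycles k A (CoindQuot k A M) n) :=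
  ((cocycles k A (Coind k A M) n).map (Cochain.map A (proj k A M) n)).submoduleOf _

/-- A cocycle m becomes a coboundary de in `Coind`, and `proj e` is then a cocycle that connects to
the class of m. -/
theorem mkQ_connecting_surjective (n : ℕ) : Function.Surjective
    (((coboundaries k A M (n + 1)).submoduleOf (cocycles k A M (n + 1))).mkQ ∘ₗ
      connecting k A M n) := by
  intro x
  obtain ⟨m, rfl⟩ := Submodule.mkQ_surjective _ x
  have hm : Cochain.map A (incl k A M) _ (m : Cochain k A M (n + 1)) ∈ cocycles k A _ (n + 1) :=
    isBimoduleHom_incl.map_mem_cocycles m.2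
  obtain ⟨e, he⟩ := cocycles_le_coboundaries n hm
  have hq : Cochain.map A (proj k A M) n e ∈ cocycles k A _ n := by
    change hochschildD _ _ _ _ _ = 0
    rw [isBimoduleHom_proj.hochschildD_map, he]
    ext a; simp
  refine ⟨⟨_, hq⟩, ?_⟩
  rw [LinearMap.comp_apply, ← sub_eq_zero, ← map_sub, Submodule.mkQ_apply,
    Submodule.Quotient.mk_eq_zero]
  -- The lift of `proj e` is e minus the embedding of e(1), so the connecting cocycle differs from m
  -- by -d(e(1)).
  refine ⟨-Cochain.map A (evalOne k A M) n e, map_incl_injective _ ?_⟩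
  rw [Submodule.subtype_apply, Submodule.coe_sub, map_sub, map_incl_connecting, ← he,
    ← isBimoduleHom_incl.hochschildD_map, ← map_sub]
  congr 1
  refine MultilinearMap.ext fun a ↦ ?_
  simp [lift_proj]

/-- If the connecting cocycle of q is dm, then subtracting the embedding of m from the lift of q
gives a cocycle over q. Conversely, a cocycle e over q differs from the lift of q by the embedding
of e(1). -/
theorem ker_mkQ_connecting (n : ℕ) : LinearMap.ker
    (((coboundaries k A M (n + 1)).submoduleOf (cocycles k A M (n + 1))).mkQ ∘ₗ
      connecting k A M n) = liftableCocycles k A M n := by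
  ext q
  rw [LinearMap.ker_comp, Submodule.ker_mkQ]
  constructor
  · rintro ⟨m, hm⟩
    refine ⟨Cochain.map A (lift k A M) n q - Cochain.map A (incl k A M) n m, ?_, ?_⟩
    · change hochschildD _ _ _ _ _ = 0
      rw [map_sub, ← map_incl_connecting, isBimoduleHom_incl.hochschildD_map, hm,
        Submodule.subtype_apply, sub_self]
    · refine MultilinearMap.ext fun a ↦ ?_
      simp
  · rintro ⟨e, he, heq⟩
    refine ⟨-Cochain.map A (evalOne k A M) n e, map_incl_injective _ ?_⟩
    rw [Submodule.subtype_apply, map_incl_connecting, ← isBimoduleHom_incl.hochschildD_map,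
      ← sub_eq_zero, ← map_sub]
    refine Eq.trans ?_ (show hochschildD k A _ n (-e) = 0 by
      rw [map_neg, show hochschildD k A _ n e = 0 from he, neg_zero])
    congr 1
    refine MultilinearMap.ext fun a ↦ ?_
    have := congr(lift k A M ($heq a))
    simp only [Cochain.map_apply, lift_proj, Submodule.subtype_apply] at this
    simp [← this]
    abel

variable (k A M) in
/-- Dimension shifting for Hochschild cohomology. -/
noncomputable def hochschildShift (n : ℕ) : HochschildCohomology k A M (n + 1) ≃ₗ[k]
    cocycles k A (CoindQuot k A M) n ⧸ liftableCocycles k A M n :=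
  (LinearMap.quotKerEquivOfSurjective (((coboundaries k A M (n + 1)).submoduleOf
    (cocycles k A M (n + 1))).mkQ ∘ₗ connecting k A M n) (mkQ_connecting_surjective n)).symm.trans
    (Submodule.quotEquivOfEq _ _ (ker_mkQ_connecting n))

/-- In positive degree, cocycles of `Coind` are coboundaries, and `proj` is surjective on cochains.
-/
theorem liftableCocycles_succ (n : ℕ) : liftableCocycles k A M (n + 1) =
    (coboundaries k A (CoindQuot k A M) (n + 1)).submoduleOf (cocycles k A _ (n + 1)) := by
  refine congrArg (Submodule.comap _) (le_antisymm ?_ ?_)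
  · rintro _ ⟨e, he, rfl⟩
    obtain ⟨f, rfl⟩ := cocycles_le_coboundaries n he
    exact ⟨Cochain.map A (proj k A M) n f, isBimoduleHom_proj.hochschildD_map f⟩
  · rintro _ ⟨f, rfl⟩
    refine ⟨hochschildD k A _ n (Cochain.map A (lift k A M) n f), hochschildD_comp_self _ _, ?_⟩
    rw [← isBimoduleHom_proj.hochschildD_map]
    congr 1
    refine MultilinearMap.ext fun a ↦ ?_
    simp

variable (k A M) in
/-- Dimension shifting for Hochschild cohomology in positive degrees. -/
noncomputable def hochschildShiftSucc (n : ℕ) : HochschildCohomology k A M (n + 2) ≃ₗ[k]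
    HochschildCohomology k A (CoindQuot k A M) (n + 1) :=
  hochschildShift k A M (n + 1) ≪≫ₗ Submodule.quotEquivOfEq _ _ (liftableCocycles_succ n)

end Shift
-- Convolution inverses of algebra homomorphisms
section ConvInverse

open WithConv Coalgebra HopfAlgebra

variable {k : Type u} {A B : Type*} [Field k] [Ring A] [HopfAlgebra k A] [Ring B] [Algebra k B]

theorem toConv_comp_antipode_mul (f : A →ₐ[k] B) :
    toConv (f.toLinearMap ∘ₗ antipode k) * toConv f.toLinearMap = 1 := by
  ext a
  rw [(ℛ k a).convMul_apply]
  simp [← map_mul, ← map_sum, sum_antipode_mul_eq_algebraMap_counit]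

theorem toConv_mul_comp_antipode (f : A →ₐ[k] B) :
    toConv f.toLinearMap * toConv (f.toLinearMap ∘ₗ antipode k) = 1 := by
  ext a
  rw [(ℛ k a).convMul_apply]
  simp [← map_mul, ← map_sum, sum_mul_antipode_eq_algebraMap_counit]

end ConvInverse

/-! ### Convolution formulas for ξ S² -/

section Nu

open WithConv Coalgebra HopfAlgebra

variable {k : Type u} {A : Type v} [Field k] [Ring A] [HopfAlgebra k A] (π : A →ₐ[k] k)

theorem windingHom_apply {a : A} {ι : Type*} (r : Repr k a ι) :
    windingHom π a = ∑ i ∈ r.index, π (r.left i) • r.right i := by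
  simp [windingHom, ← r.eq]

theorem toConv_windingHom : toConv (windingHom π).toLinearMap =
    toConv ((Algebra.ofId k A).comp π).toLinearMap * toConv LinearMap.id := by
  ext a
  rw [(ℛ k a).convMul_apply]
  simp [windingHom_apply π (ℛ k a), Algebra.smul_def, Algebra.ofId_apply]

/-- Since ξ = π * id in the convolution algebra, its inverse ξ ∘ S must be S * (π ∘ S). -/
theorem toConv_windingHom_comp_antipode :
    toConv ((windingHom π).toLinearMap ∘ₗ antipode k) =
      toConv (antipode k) * toConv (((Algebra.ofId k A).comp π).toLinearMap ∘ₗ antipode k) := by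
  refine left_inv_eq_right_inv (toConv_comp_antipode_mul (windingHom π)) ?_
  rw [toConv_windingHom, mul_assoc, ← mul_assoc (toConv LinearMap.id), LinearMap.id_mul_antipode,
    one_mul, toConv_mul_comp_antipode]

/-- The algebra homomorphism `a ↦ ξ(S(a))` from `A` to the opposite algebra, for the winding
endomorphism `ξ` of a character. -/
noncomputable def windingAntipode : A →ₐ[k] Aᵐᵒᵖ :=
  (AlgHom.op (windingHom π)).comp (antipodeAlgHomOp k A)

/-- Uniqueness of inverses again, now for maps to Aᵐᵒᵖ: there ξ ∘ S is an algebra homomorphism with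
inverse ξ ∘ S², and it equals S * (π ∘ S), whose inverse is π * S². -/
theorem toConv_op_windingHom_antipodeSq :
    toConv ((MulOpposite.opLinearEquiv k).toLinearMap ∘ₗ (windingHom π).toLinearMap ∘ₗ
      antipode k ∘ₗ antipode k) =
      toConv ((Algebra.ofId k Aᵐᵒᵖ).comp π).toLinearMap *
        toConv ((antipodeAlgHomOp k A).toLinearMap ∘ₗ antipode k) := by
  refine left_inv_eq_right_inv (toConv_comp_antipode_mul (windingAntipode π)) ?_
  have h : toConv (windingAntipode π).toLinearMap = toConv (antipodeAlgHomOp k A).toLinearMap *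
      toConv (((Algebra.ofId k Aᵐᵒᵖ).comp π).toLinearMap ∘ₗ antipode k) := by
    ext a
    have := congr($(toConv_windingHom_comp_antipode π) a)
    rw [(ℛ k a).convMul_apply] at this
    rw [(ℛ k a).convMul_apply]
    apply MulOpposite.unop_injective
    simp [windingAntipode, Algebra.ofId_apply] at this ⊢
    rw [this]
    -- Passing to Aᵐᵒᵖ reverses the factors, which is harmless because one of them is a scalar.
    exact Finset.sum_congr rfl fun i _ ↦ (Algebra.commutes _ _).symm
  rw [h, mul_assoc, ← mul_assoc (toConv (_ ∘ₗ antipode k)), toConv_comp_antipode_mul, one_mul,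
    toConv_mul_comp_antipode]

theorem windingHom_antipode_antipode {a : A} {ι : Type*} (r : Repr k a ι) :
    windingHom π (antipode k (antipode k a)) =
      ∑ i ∈ r.index, π (r.left i) • antipode k (antipode k (r.right i)) := by
  have := congr($(toConv_op_windingHom_antipodeSq π) a)
  rw [r.convMul_apply] at this
  simp only [Algebra.smul_def, Algebra.commutes]
  apply MulOpposite.op_injective
  simpa [Algebra.ofId_apply] using this

/-- `∑ S(a₂) ξ(S²(a₁)) = π(a)`. -/
theorem sum_antipode_mul_windingHom {a : A} {ι : Type*} (r : Repr k a ι) :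
    ∑ i ∈ r.index, antipode k (r.right i) * windingHom π (antipode k (antipode k (r.left i))) =
      π a • 1 := by
  -- Convolving with S cancels S² in Hom(A, Aᵐᵒᵖ); the opposite product puts S(a₂) on the left.
  have h := congr($(toConv_op_windingHom_antipodeSq π) *
    toConv (antipodeAlgHomOp k A).toLinearMap)
  rw [mul_assoc, toConv_comp_antipode_mul, mul_one] at h
  have := congr($h a)
  rw [r.convMul_apply] at this
  apply MulOpposite.op_injective
  simpa [Algebra.ofId_apply, Algebra.algebraMap_eq_smul_one] using this

end Nu

/-! ### The adjoint module of a bimodule -/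

section Adj

open WithConv Coalgebra HopfAlgebra MulOpposite

variable (k : Type u) (A : Type v) (M : Type w) [Field k] [Ring A] [HopfAlgebra k A]
  [AddCommGroup M] [Module k M] [Module A M] [Module Aᵐᵒᵖ M] [SMulCommClass A Aᵐᵒᵖ M]
  [IsScalarTower k A M] [IsScalarTower k Aᵐᵒᵖ M]

/-- The adjoint action `a · m = ∑ a₁ m S(a₂)` of a Hopf algebra on a bimodule. -/
noncomputable def adjointAction : A →ₐ[k] Module.End k M :=
  (Algebra.TensorProduct.lift (Algebra.lsmul k k M)
    ((Algebra.lsmul k k M).comp (antipodeAlgHomOp k A))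
    fun a b ↦ by ext m; simp [smul_comm]).comp (Bialgebra.comulAlgHom k A)

variable {A M} in
theorem adjointAction_apply {a : A} {ι : Type*} (r : Repr k a ι) (m : M) :
    adjointAction k A M a m = ∑ i ∈ r.index, r.left i • op (antipode k (r.right i)) • m := by
  simp [adjointAction, ← r.eq]
  rfl

/-- A bimodule over a Hopf algebra as a left module under the adjoint action. -/
def Adj (_k : Type u) (_A : Type v) (M : Type w) : Type w := M

namespace Adj

instance : AddCommGroup (Adj k A M) := inferInstanceAs (AddCommGroup M)
instance : Module k (Adj k A M) := inferInstanceAs (Module k M)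
noncomputable instance : Module A (Adj k A M) :=
  Module.compHom M (adjointAction k A M : A →+* Module.End k M)
instance : IsScalarTower k A (Adj k A M) where
  smul_assoc c a m := by
    change adjointAction k A M (c • a) m = c • adjointAction k A M a m
    rw [map_smul]
    rfl

/-- The identity map of a bimodule to the adjoint module. -/
def of : M ≃ₗ[k] Adj k A M := LinearEquiv.refl k M

variable {k A M}

theorem smul_of {a : A} {ι : Type*} (r : Repr k a ι) (m : M) : a • of k A M m =
    of k A M (∑ i ∈ r.index, r.left i • op (antipode k (r.right i)) • m) :=
  adjointAction_apply k r m

/-- `∑ a₁ · (m S²(a₂)) = a m`. -/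
theorem sum_smul_of {a : A} {ι : Type*} (r : Repr k a ι) (m : M) :
    ∑ i ∈ r.index, r.left i • of k A M (op (antipode k (antipode k (r.right i))) • m) =
      of k A M (a • m) := by
  -- R(a) is right multiplication by S(a), so the adjoint action is the convolution of left
  -- multiplication with R. Convolving with R ∘ S, right multiplication by S²(a), removes R.
  let R : A →ₐ[k] Module.End k M := (Algebra.lsmul k k M).comp (antipodeAlgHomOp k A)
  have h1 : toConv (adjointAction k A M).toLinearMap =
      toConv (Algebra.lsmul k k M : A →ₐ[k] Module.End k M).toLinearMap * toConv R.toLinearMap := by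
    ext a m
    rw [(ℛ k a).convMul_apply]
    simp [adjointAction_apply k (ℛ k a), R, LinearMap.sum_apply]
  have h2 := congr($h1 * toConv (R.toLinearMap ∘ₗ antipode k))
  rw [mul_assoc, toConv_mul_comp_antipode, mul_one] at h2
  have h3 := congr($h2 a)
  rw [r.convMul_apply] at h3
  have h4 := congr($h3 m)
  simp only [LinearMap.sum_apply] at h4
  exact h4

/-- The map `a ↦ ∑ ψ(a₁) f(a₂)` for linear maps `ψ` from `A` to a bimodule and `f` from `A`
to `A`. -/
noncomputable def convSMul (ψ : A →ₗ[k] M) (f : A →ₗ[k] A) : A →ₗ[k] M :=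
  TensorProduct.lift (((Algebra.lsmul k k M : Aᵐᵒᵖ →ₐ[k] _).toLinearMap.flip ∘ₗ ψ).compl₂
    ((opLinearEquiv k).toLinearMap ∘ₗ f)) ∘ₗ comul

theorem convSMul_apply (ψ : A →ₗ[k] M) (f : A →ₗ[k] A) {a : A} {ι : Type*} (r : Repr k a ι) :
    convSMul ψ f a = ∑ i ∈ r.index, op (f (r.right i)) • ψ (r.left i) := by
  simp [convSMul, ← r.eq]

/-- By coassociativity, Hom_k(A, M) is a right module over the convolution algebra of A. -/
theorem convSMul_convSMul (ψ : A →ₗ[k] M) (f g : A →ₗ[k] A) :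
    convSMul (convSMul ψ f) g = convSMul ψ (toConv f * toConv g).ofConv := by
  let G : A ⊗[k] (A ⊗[k] A) →ₗ[k] M :=
    TensorProduct.lift (((Algebra.lsmul k k M : Aᵐᵒᵖ →ₐ[k] _).toLinearMap.flip ∘ₗ ψ).compl₂
      ((opLinearEquiv k).toLinearMap ∘ₗ LinearMap.mul' k A ∘ₗ TensorProduct.map f g))
  have h1 : TensorProduct.lift (((Algebra.lsmul k k M : Aᵐᵒᵖ →ₐ[k] _).toLinearMap.flip ∘ₗ
      TensorProduct.lift (((Algebra.lsmul k k M : Aᵐᵒᵖ →ₐ[k] _).toLinearMap.flip ∘ₗ ψ).compl₂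
      ((opLinearEquiv k).toLinearMap ∘ₗ f))).compl₂ ((opLinearEquiv k).toLinearMap ∘ₗ g)) =
      G ∘ₗ (TensorProduct.assoc k A A A).toLinearMap := by
    ext a b c
    simp [G]
  have h2 : convSMul ψ (toConv f * toConv g).ofConv = G ∘ₗ comul.lTensor A ∘ₗ comul := by
    rw [← LinearMap.comp_assoc]
    refine congrArg (· ∘ₗ comul) ?_
    ext a b
    rfl
  ext a
  have h3 := congr($h1 ((comul (R := k)).rTensor A (comul a)))
  rw [LinearMap.comp_apply, LinearEquiv.coe_coe, coassoc_apply] at h3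
  rw [h2]
  refine Eq.trans ?_ h3
  rw [convSMul_apply _ _ (ℛ k a)]
  conv_rhs => rw [← (ℛ k a).eq]
  simp [convSMul]

theorem convSMul_one (ψ : A →ₗ[k] M) : convSMul ψ (1 : WithConv (A →ₗ[k] A)).ofConv = ψ := by
  ext a
  rw [convSMul_apply _ _ (ℛ k a)]
  have h := congr(TensorProduct.rid k A $(sum_tmul_counit_eq (R := k) (ℛ k a)))
  rw [map_sum, TensorProduct.rid_tmul, one_smul] at h
  conv_rhs => rw [← h]
  simp [MulOpposite.op_smul, Algebra.algebraMap_eq_smul_one]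

variable (k A) in
/-- The left multiplication `a ↦ a m`. -/
def orbit (m : M) : A →ₗ[k] M := (LinearMap.toSpanSingleton A M m).restrictScalars k

/-- `∑ (a₁ · m) a₂ = a m`. -/
theorem sum_op_smul_adjoint {a : A} {ι : Type*} (r : Repr k a ι) (m : M) :
    ∑ i ∈ r.index, op (r.right i) • (of k A M).symm (r.left i • of k A M m) = a • m := by
  -- Convolving a ↦ a m with S gives a ↦ a · m, and convolving further with the identity undoes
  -- this.
  have h := convSMul_convSMul (orbit k A m) (antipode k) LinearMap.id
  rw [LinearMap.antipode_mul_id, convSMul_one] at h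
  have h2 := congr($h a)
  rw [convSMul_apply _ _ r] at h2
  refine Eq.trans (Finset.sum_congr rfl fun i _ ↦ ?_) h2
  rw [smul_of (ℛ k (r.left i)), LinearEquiv.symm_apply_apply, convSMul_apply _ _ (ℛ k (r.left i))]
  simp [orbit, smul_comm]

/-- The adjoint invariants are the central elements of the bimodule. -/
theorem smul_of_eq_counit_smul_iff (m : M) :
    (∀ a : A, a • of k A M m = counit (R := k) a • of k A M m) ↔ ∀ a : A, a • m = op a • m := by
  constructor
  · intro h a
    rw [← sum_op_smul_adjoint (ℛ k a) m]
    simp only [h, map_smul, LinearEquiv.symm_apply_apply]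
    conv_rhs => rw [← sum_counit_smul (R := k) (ℛ k a)]
    rw [Finset.op_sum, Finset.sum_smul]
    refine Finset.sum_congr rfl fun i _ ↦ ?_
    rw [MulOpposite.op_smul, smul_assoc, smul_comm]
  · intro h a
    rw [smul_of (ℛ k a), ← map_smul]
    congr 1
    simp only [smul_comm (_ : A) (op _) m, h]
    simp only [smul_smul, ← op_mul, ← Finset.sum_smul, ← Finset.op_sum]
    rw [sum_mul_antipode_eq_smul]
    simp

variable (M) in
/-- The untwisting of the adjoint module of a coinduced bimodule. -/
noncomputable def coindLinearMap (φ : Adj k A (Coind k A M)) : A →ₗ[k] M where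
  toFun b := (of k A (Coind k A M)).symm (b • φ) 1
  map_add' b c := by rw [add_smul, map_add, Coind.add_apply]
  map_smul' r b := by rw [smul_assoc, map_smul, Coind.smul_apply, RingHom.id_apply]

theorem coindLinearMap_apply (φ : Adj k A (Coind k A M)) (b : A) :
    coindLinearMap M φ b = (of k A (Coind k A M)).symm (b • φ) 1 := rfl

/-- The value at 1 of b · φ is ∑ φ(b₁) S(b₂). So untwisting is convolution with S, inverted by
convolution with the identity. -/
theorem coindLinearMap_of (φ : Coind k A M) : coindLinearMap M (of k A (Coind k A M) φ) =
    convSMul (show A →ₗ[k] M from φ) (antipode k) := by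
  ext b
  rw [coindLinearMap_apply, smul_of (ℛ k b), convSMul_apply _ _ (ℛ k b)]
  simp
  rfl

theorem exists_coindLinearMap_eq (ψ : A →ₗ[k] M) :
    ∃ φ : Adj k A (Coind k A M), coindLinearMap M φ = ψ := by
  refine ⟨of k A (Coind k A M) (show Coind k A M from convSMul ψ LinearMap.id), ?_⟩
  rw [coindLinearMap_of]
  refine (convSMul_convSMul ψ LinearMap.id (antipode k)).trans ?_
  rw [LinearMap.id_mul_antipode, convSMul_one]

theorem coindLinearMap_injective :
    Function.Injective (coindLinearMap M : Adj k A (Coind k A M) → A →ₗ[k] M) := by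
  have h : ∀ φ : Coind k A M, convSMul (coindLinearMap M (of k A _ φ)) LinearMap.id =
      (show A →ₗ[k] M from φ) := by
    intro φ
    rw [coindLinearMap_of, convSMul_convSMul, LinearMap.antipode_mul_id, convSMul_one]
  intro φ ψ hφψ
  obtain ⟨φ, rfl⟩ := (of k A _).surjective φ
  obtain ⟨ψ, rfl⟩ := (of k A _).surjective ψ
  have h1 := h φ
  rw [hφψ, h ψ] at h1
  exact congrArg _ h1.symm

/-- Untwisted, the module is Hom_k(A, M) with (a ψ)(b) = ψ(b a), coinduced from k. A-linear maps
into it amount to k-linear maps into M, which extend along injections since k is a field. -/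
theorem injective_adj_coind {M : Type v}
    [AddCommGroup M] [Module k M] [Module A M] [Module Aᵐᵒᵖ M] [SMulCommClass A Aᵐᵒᵖ M]
    [IsScalarTower k A M] [IsScalarTower k Aᵐᵒᵖ M] :
    Module.Injective A (Adj k A (Coind k A M)) where
  out X Y _ _ _ _ f hf g := by
    let _ : Module k X := Module.compHom X (algebraMap k A)
    let _ : Module k Y := Module.compHom Y (algebraMap k A)
    have : IsScalarTower k A X := ⟨fun c a x ↦ by
      rw [Algebra.smul_def, mul_smul]; rfl⟩
    have : IsScalarTower k A Y := ⟨fun c a x ↦ by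
      rw [Algebra.smul_def, mul_smul]; rfl⟩
    let g₁ : X →ₗ[k] M := Coind.evalOne k A M ∘ₗ (of k A _).symm.toLinearMap ∘ₗ
      g.restrictScalars k
    obtain ⟨s, hs⟩ := (f.restrictScalars k).exists_leftInverse_of_injective
      (LinearMap.ker_eq_bot.2 hf)
    have hs' : ∀ x, s (f x) = x := fun x ↦ congr($hs x)
    -- The k-linear extension g₁ ∘ s of the map into M, read as a map into the coinduced module.
    let ψ : Y → A →ₗ[k] M := fun y ↦
      g₁ ∘ₗ s ∘ₗ (LinearMap.toSpanSingleton A Y y).restrictScalars k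
    have hψ : ∀ y b, ψ y b = g₁ (s (b • y)) := fun _ _ ↦ rfl
    choose t ht using fun y ↦ exists_coindLinearMap_eq (ψ y)
    refine ⟨{ toFun := t, map_add' := fun y z ↦ ?_, map_smul' := fun a y ↦ ?_ }, fun x ↦ ?_⟩
    · apply coindLinearMap_injective
      ext b
      have h1 := congr($(ht y) b)
      have h2 := congr($(ht z) b)
      rw [coindLinearMap_apply] at h1 h2
      rw [ht, hψ, smul_add, map_add, map_add, coindLinearMap_apply, smul_add, map_add,
        Coind.add_apply, h1, h2, hψ, hψ]
    · apply coindLinearMap_injective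
      ext b
      have h1 := congr($(ht y) (b * a))
      rw [coindLinearMap_apply] at h1
      rw [ht, hψ, RingHom.id_apply, coindLinearMap_apply, smul_smul, smul_smul, h1, hψ]
    · apply coindLinearMap_injective
      ext b
      change coindLinearMap M (t (f x)) b = _
      rw [ht, hψ, ← map_smul, hs', coindLinearMap_apply, ← map_smul]
      rfl

end Adj

/-- The spans of the elements `a m - m ν(a)` and `a · m - π(a) m` agree for `ν = ξ S²`. -/
theorem span_twisted_commutators (π : A →ₐ[k] k) (ν : A → A)
    (hν : ∀ a, ν a = windingHom π (antipode k (antipode k a))) :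
    Submodule.span k {x : Adj k A M | ∃ (a : A) (m : Adj k A M), x = a • m - π a • m} =
    (Submodule.span k {x : M | ∃ (a : A) (m : M), x = a • m - op (ν a) • m}).map
      (Adj.of k A M).toLinearMap := by
  apply le_antisymm
  · rw [Submodule.span_le]
    rintro _ ⟨a, m, rfl⟩
    obtain ⟨m, rfl⟩ := (Adj.of k A M).surjective m
    -- Here π(a) = ∑ S(a₂) ν(a₁) acts on the right of m, so a · m - π(a) m is a sum of relations for
    -- the pairs a₁, m S(a₂).
    have h : π a • m = ∑ i ∈ (ℛ k a).index,
        op (ν ((ℛ k a).left i)) • op (antipode k ((ℛ k a).right i)) • m := by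
      simp only [smul_smul, ← op_mul, ← Finset.sum_smul, ← Finset.op_sum, hν]
      rw [sum_antipode_mul_windingHom]
      simp
    refine ⟨∑ i ∈ (ℛ k a).index, ((ℛ k a).left i • op (antipode k ((ℛ k a).right i)) • m -
      op (ν ((ℛ k a).left i)) • op (antipode k ((ℛ k a).right i)) • m),
      Submodule.sum_mem _ fun i _ ↦ Submodule.subset_span ⟨_, _, rfl⟩, ?_⟩
    rw [Finset.sum_sub_distrib, ← h, map_sub, map_smul, Adj.smul_of (ℛ k a)]
    rfl
  · rw [Submodule.map_le_iff_le_comap, Submodule.span_le]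
    rintro _ ⟨a, m, rfl⟩
    -- Conversely a m = ∑ a₁ · (m S²(a₂)) and m ν(a) = ∑ π(a₁) m S²(a₂), compared term by term.
    rw [SetLike.mem_coe, Submodule.mem_comap, LinearEquiv.coe_coe, map_sub,
      ← Adj.sum_smul_of (ℛ k a), hν, windingHom_antipode_antipode π (ℛ k a), Finset.op_sum,
      Finset.sum_smul, map_sum, ← Finset.sum_sub_distrib]
    refine Submodule.sum_mem _ fun i _ ↦ Submodule.subset_span ⟨(ℛ k a).left i,
      Adj.of k A M (op (antipode k (antipode k ((ℛ k a).right i))) • m), ?_⟩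
    rw [op_smul, smul_assoc, (Adj.of k A M).map_smul]

end Adj
-- The top Ext group as a space of coinvariants
section TopExt

open CategoryTheory Abelian

variable {k : Type u} {B : Type v} [Field k] [Ring B] [Algebra k B]

/-- A class in `Extⁿ(X, N)` with `X` finitely generated over a noetherian ring comes from a finitely
generated module. -/
theorem exists_finite_comp_eq [IsNoetherianRing B] (n : ℕ) (X N : ModuleCat.{v} B)
    [Module.Finite B X] (x : Ext X N n) :
    ∃ (L : ModuleCat.{v} B) (_ : Module.Finite B L) (f : L ⟶ N) (y : Ext X L n),
      y.comp (Ext.mk₀ f) (add_zero n) = x := by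
  induction n generalizing X with
  | zero => exact ⟨X, ‹_›, Ext.homEquiv₀ x, Ext.mk₀ (𝟙 X), by simp⟩
  | succ n ih =>
    -- The kernel of a finite free cover of X is again finitely generated, and the class comes from
    -- it one degree lower.
    obtain ⟨m, g, hg⟩ := Module.Finite.exists_fin' B X
    have hS := LinearMap.shortExact_shortComplexKer hg
    have : Projective g.shortComplexKer.X₂ :=
      ModuleCat.projective_of_categoryTheory_projective (ModuleCat.of B (Fin m → B))
    have : Module.Finite B g.shortComplexKer.X₁ :=
      inferInstanceAs (Module.Finite B (LinearMap.ker g))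
    obtain ⟨x', hx'⟩ := Ext.contravariant_sequence_exact₃ hS N x (Ext.eq_zero_of_projective _)
      (add_comm 1 n)
    obtain ⟨L, hL, f, y, rfl⟩ := ih g.shortComplexKer.X₁ x'
    refine ⟨L, hL, f, hS.extClass.comp y (add_comm 1 n), ?_⟩
    rw [← hx', Ext.comp_assoc_of_third_deg_zero]

/-- Right exactness of the top Ext group. -/
theorem exists_comp_mk₀_eq {d : ℕ} (X : ModuleCat.{v} B) [HasProjectiveDimensionLT X (d + 1)]
    {L N : Type v} [AddCommGroup L] [Module B L] [AddCommGroup N] [Module B N] (f : L →ₗ[B] N)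
    (hf : Function.Surjective f) (x : Ext X (ModuleCat.of B N) d) :
    ∃ y : Ext X (ModuleCat.of B L) d, y.comp (Ext.mk₀ (ModuleCat.ofHom f)) (add_zero d) = x :=
  Ext.covariant_sequence_exact₃ X (LinearMap.shortExact_shortComplexKer hf) x rfl
    (Ext.eq_zero_of_hasProjectiveDimensionLT _ (d + 1) le_rfl)

theorem exists_comp_subtype_eq {n : ℕ} (X : ModuleCat.{v} B) {L N : Type v} [AddCommGroup L]
    [Module B L] [AddCommGroup N] [Module B N] (f : L →ₗ[B] N) (hf : Function.Surjective f)
    (x : Ext X (ModuleCat.of B L) n)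
    (hx : x.comp (Ext.mk₀ (ModuleCat.ofHom f)) (add_zero n) = 0) :
    ∃ y : Ext X (ModuleCat.of B (LinearMap.ker f)) n,
      y.comp (Ext.mk₀ (ModuleCat.ofHom (LinearMap.ker f).subtype)) (add_zero n) = x :=
  Ext.covariant_sequence_exact₂ X (LinearMap.shortExact_shortComplexKer hf) x hx

variable {X : ModuleCat.{v} B} {d : ℕ} (e : Ext X (regularModule B) d)
  (N : Type v) [AddCommGroup N] [Module k N] [Module B N] [IsScalarTower k B N]

variable (k) in
/-- The map `N → Ext^d(X, N)` that sends `n` to the image of a class in `Ext^d(X, B)` under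
`b ↦ b n`. -/
noncomputable def pushClass : N →ₗ[k] Ext X (ModuleCat.of B N) d where
  toFun n := e.comp (Ext.mk₀ (ModuleCat.ofHom (LinearMap.toSpanSingleton B N n))) (add_zero d)
  map_add' m n := by
    rw [LinearMap.toSpanSingleton_add, ModuleCat.ofHom_add, Ext.mk₀_add, Ext.comp_add]
  map_smul' c n := by
    rw [RingHom.id_apply, ← Ext.comp_smul, ← Ext.mk₀_smul]
    congr 2
    ext
    change (1 : B) • c • n = algebraMap k B c • (1 : B) • n
    simp

variable {N}

theorem pushClass_apply (n : N) : pushClass k e N n =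
    e.comp (Ext.mk₀ (ModuleCat.ofHom (LinearMap.toSpanSingleton B N n))) (add_zero d) := rfl

theorem pushClass_comp {N' : Type v} [AddCommGroup N'] [Module k N'] [Module B N']
    [IsScalarTower k B N'] (f : N →ₗ[B] N') (n : N) :
    (pushClass k e N n).comp (Ext.mk₀ (ModuleCat.ofHom f)) (add_zero d) =
      pushClass k e N' (f n) := by
  rw [pushClass_apply, Ext.comp_assoc_of_third_deg_zero, Ext.mk₀_comp_mk₀, pushClass_apply]
  congr 2
  ext
  simp

/-- A class comes from a finitely generated L, then by right exactness from a finite free module,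
where its coordinates are multiples of e. -/
theorem pushClass_surjective [IsNoetherianRing B] [Module.Finite B X]
    [HasProjectiveDimensionLT X (d + 1)]
    (hgen : ∀ y : Ext X (regularModule B) d, ∃ c : k, c • e = y) :
    Function.Surjective (pushClass k e N) := by
  intro x
  obtain ⟨L, hL, f, y, rfl⟩ := exists_finite_comp_eq d X (ModuleCat.of B N) x
  obtain ⟨m, g, hg⟩ := Module.Finite.exists_fin' B L
  obtain ⟨z, rfl⟩ := exists_comp_mk₀_eq X g hg y
  choose c hc using fun i : Fin m ↦
    hgen (z.comp (Ext.mk₀ (ModuleCat.ofHom (LinearMap.proj i))) (add_zero d))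
  have hid : 𝟙 (ModuleCat.of B (Fin m → B)) = ∑ i : Fin m, ModuleCat.ofHom (LinearMap.proj i) ≫
      ModuleCat.ofHom (LinearMap.toSpanSingleton B (Fin m → B) (Pi.single i 1)) := by
    ext : 1
    rw [ModuleCat.hom_sum]
    refine LinearMap.ext fun v ↦ ?_
    rw [LinearMap.sum_apply]
    simpa using (pi_eq_sum_univ' v)
  have hz : z = ∑ i, c i • pushClass k e (Fin m → B) (Pi.single i 1) := by
    conv_lhs => rw [← Ext.comp_mk₀_id z, hid, Ext.mk₀_sum, Ext.comp_sum]
    refine Finset.sum_congr rfl fun i _ ↦ ?_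
    rw [pushClass_apply, ← Ext.smul_comp, hc, Ext.comp_assoc_of_third_deg_zero, Ext.mk₀_comp_mk₀]
  refine ⟨∑ i, c i • f.hom (g (Pi.single i 1)), ?_⟩
  rw [hz, Ext.comp_assoc_of_third_deg_zero, Ext.mk₀_comp_mk₀, Ext.sum_comp, map_sum]
  refine Finset.sum_congr rfl fun i _ ↦ ?_
  rw [map_smul, Ext.smul_comp]
  congr 1
  exact (pushClass_comp e (f.hom ∘ₗ g) _).symm

variable (N) in
/-- The subspace of a module spanned by all `b n - π(b) n`. -/
def characterRelations (π : B →ₐ[k] k) : Submodule k N :=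
  Submodule.span k {x | ∃ (b : B) (n : N), x = b • n - π b • n}

theorem map_mem_characterRelations {π : B →ₐ[k] k} {N' : Type v} [AddCommGroup N'] [Module k N']
    [Module B N'] [IsScalarTower k B N'] (f : N →ₗ[B] N') {n : N}
    (hn : n ∈ characterRelations N π) : f n ∈ characterRelations N' π := by
  suffices h : characterRelations N π ≤ (characterRelations N' π).comap (f.restrictScalars k) from
    h hn
  refine Submodule.span_le.2 ?_
  rintro _ ⟨b, n, rfl⟩
  refine Submodule.subset_span ⟨b, f n, ?_⟩
  rw [map_sub, (f.restrictScalars k).map_smul (π b)]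
  simp

-- Coordinate projections send the pushed class of p to π(pᵢ) e, so all π(pᵢ) vanish. Only
-- projections enter, so the rank may be infinite.
variable {e} in
theorem mem_characterRelations_of_pushClass_finsupp {π : B →ₐ[k] k} (he : e ≠ 0)
    (hπ : ∀ b, pushClass k e B b = π b • e) {ι : Type v} {p : ι →₀ B}
    (hp : pushClass k e (ι →₀ B) p = 0) : p ∈ characterRelations (ι →₀ B) π := by
  have h : ∀ i, π (p i) = 0 := by
    intro i
    have h := pushClass_comp (k := k) e (Finsupp.lapply i) p
    rw [hp, Ext.zero_comp, Finsupp.lapply_apply, hπ] at h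
    exact (smul_eq_zero.1 h.symm).resolve_right he
  rw [← Finsupp.sum_single p]
  refine Submodule.sum_mem _ fun i _ ↦ Submodule.subset_span ⟨p i, Finsupp.single i 1, ?_⟩
  simp [h]

-- If p dies in Ext(X, N), its pushed class comes from Ext(X, ker q), hence is pushed from some κ in
-- ker q. Then p - κ has zero pushed class and the same image as p.
variable {e} in
theorem mem_characterRelations_of_surjective [IsNoetherianRing B] [Module.Finite B X]
    [HasProjectiveDimensionLT X (d + 1)] {π : B →ₐ[k] k}
    (hgen : ∀ y : Ext X (regularModule B) d, ∃ c : k, c • e = y) {P : Type v}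
    [AddCommGroup P] [Module k P] [Module B P] [IsScalarTower k B P]
    (q : P →ₗ[B] N) (hq : Function.Surjective q)
    (hP : ∀ p, pushClass k e P p = 0 → p ∈ characterRelations P π)
    (p : P) (hp : pushClass k e N (q p) = 0) : q p ∈ characterRelations N π := by
  obtain ⟨y, hy⟩ := exists_comp_subtype_eq X q hq (pushClass k e P p)
    ((pushClass_comp e q p).trans hp)
  obtain ⟨κ, rfl⟩ := pushClass_surjective (k := k) e hgen y
  rw [pushClass_comp] at hy
  have h : q (p - κ) = q p := by rw [map_sub, LinearMap.mem_ker.1 κ.2, sub_zero]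
  rw [← h]
  exact map_mem_characterRelations q (hP _ (by
    rw [map_sub, ← hy, Submodule.subtype_apply, sub_self]))

-- One inclusion descends from a free cover of N. The other is naturality along b ↦ b n, which gives
-- e (b n) = π(b) e n.
variable {e} in
theorem ker_pushClass [IsNoetherianRing B] [Module.Finite B X]
    [HasProjectiveDimensionLT X (d + 1)] {π : B →ₐ[k] k}
    (hgen : ∀ y : Ext X (regularModule B) d, ∃ c : k, c • e = y) (he : e ≠ 0)
    (hπ : ∀ b, pushClass k e B b = π b • e) :
    LinearMap.ker (pushClass k e N) = characterRelations N π := by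
  apply le_antisymm
  · intro n hn
    obtain ⟨q, hq⟩ : ∃ q : (N →₀ B) →ₗ[B] N, Function.Surjective q :=
      ⟨_, Finsupp.linearCombination_id_surjective B N⟩
    obtain ⟨p, rfl⟩ := hq n
    exact mem_characterRelations_of_surjective hgen q hq
      (fun _ ↦ mem_characterRelations_of_pushClass_finsupp he hπ) p hn
  · refine Submodule.span_le.2 ?_
    rintro _ ⟨b, n, rfl⟩
    change pushClass k e N _ = 0
    have h := pushClass_comp (k := k) e (LinearMap.toSpanSingleton B N n) b
    rw [hπ, Ext.smul_comp, LinearMap.toSpanSingleton_apply] at h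
    rw [map_sub, ← h, (pushClass k e N).map_smul (π b), pushClass_apply, sub_self]

end TopExt

/-! ### The top Ext group for an Artin–Schelter regular algebra -/

section ASRegular

open CategoryTheory Abelian

variable {k : Type u} {B : Type v} [Field k] [Ring B] [Algebra k B] {ε : B →ₐ[k] k} {d : ℕ}

theorem hasProjectiveDimensionLT_of_globalDimension_eq (h : globalDimension B = d)
    (X : ModuleCat.{v} B) : HasProjectiveDimensionLT X (d + 1) :=
  (projectiveDimension_le_iff X d).1 (h ▸ le_iSup (fun M ↦ projectiveDimension M) X)

/-- The top Ext group of the trivial module with coefficients in `N` is the space of coinvariants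
of `N` for the character of the left integral. -/
noncomputable def extTrivialEquiv [IsNoetherianRing B] (hB : IsASRegular ε d) (N : Type v)
    [AddCommGroup N] [Module k N] [Module B N] [IsScalarTower k B N] :
    Ext (trivialModule ε) (ModuleCat.of B N) d ≃ₗ[k]
      N ⧸ characterRelations N (integralCharacter hB.left) := by
  have h := finrank_eq_one_iff'.1 hB.left.finrank_ext
  have he := h.choose_spec
  have := hasProjectiveDimensionLT_of_globalDimension_eq hB.globalDimension_eq (trivialModule ε)
  exact (LinearMap.quotKerEquivOfSurjective _ (pushClass_surjective h.choose he.2)).symm.trans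
    (Submodule.quotEquivOfEq _ _ (ker_pushClass he.2 he.1 fun b ↦
      rightAct_eq_integralCharacter_smul hB.left b h.choose))

end ASRegular

/-! ### Dimension shifting for Ext -/

section ExtShift

open CategoryTheory Abelian

variable (k : Type u) {B : Type v} [Field k] [Ring B] [Algebra k B] (X : ModuleCat.{v} B)
  {S : ShortComplex (ModuleCat.{v} B)} (hS : S.ShortExact) [Injective S.X₂]

/-- Dimension shifting for Ext along an embedding in an injective module. -/
noncomputable def extShift (n : ℕ) : Ext X S.X₁ (n + 1) ≃ₗ[k] Ext X S.X₃ n ⧸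
    LinearMap.range ((Ext.mk₀ S.g).postcompOfLinear k X (add_zero n)) := by
  let δ : Ext X S.X₃ n →ₗ[k] Ext X S.X₁ (n + 1) := hS.extClass.postcompOfLinear k X rfl
  have h1 : Function.Surjective δ := fun x ↦
    Ext.covariant_sequence_exact₁ X hS x (Ext.eq_zero_of_injective _) rfl
  have h2 : LinearMap.ker δ =
      LinearMap.range ((Ext.mk₀ S.g).postcompOfLinear k X (add_zero n)) := by
    apply le_antisymm
    · intro x hx
      exact Ext.covariant_sequence_exact₃ X hS x rfl hx
    · rintro _ ⟨y, rfl⟩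
      change (y.comp (Ext.mk₀ S.g) (add_zero n)).comp hS.extClass rfl = 0
      rw [Ext.comp_assoc_of_second_deg_zero, hS.comp_extClass, Ext.comp_zero]
  exact (LinearMap.quotKerEquivOfSurjective δ h1).symm.trans (Submodule.quotEquivOfEq _ _ h2)

/-- Dimension shifting for Ext along an embedding in an injective module, in positive degrees. -/
noncomputable def extShiftSucc (n : ℕ) : Ext X S.X₁ (n + 2) ≃ₗ[k] Ext X S.X₃ (n + 1) :=
  (extShift k X hS (n + 1)).trans <| Submodule.quotEquivOfEqBot _ <| LinearMap.range_eq_bot.2 <|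
    LinearMap.ext fun x ↦ by rw [Ext.eq_zero_of_injective x, map_zero, map_zero]

end ExtShift

/-! ### Hochschild cohomology as Ext from the trivial module -/

section Comparison

open CategoryTheory Abelian Coalgebra

variable (k : Type u) (A : Type v) (M : Type v) [Field k] [Ring A] [HopfAlgebra k A]
  [AddCommGroup M] [Module k M] [Module A M] [Module Aᵐᵒᵖ M] [SMulCommClass A Aᵐᵒᵖ M]
  [IsScalarTower k A M] [IsScalarTower k Aᵐᵒᵖ M]

variable {k A M} in
/-- A bimodule homomorphism is linear for the adjoint actions. -/
noncomputable def Adj.map {N : Type v} [AddCommGroup N] [Module k N] [Module A N] [Module Aᵐᵒᵖ N]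
    [SMulCommClass A Aᵐᵒᵖ N] [IsScalarTower k A N] [IsScalarTower k Aᵐᵒᵖ N] {φ : M →ₗ[k] N}
    (hφ : IsBimoduleHom A φ) : Adj k A M →ₗ[A] Adj k A N where
  toFun m := Adj.of k A N (φ ((Adj.of k A M).symm m))
  map_add' m n := by simp
  map_smul' a m := by
    obtain ⟨m, rfl⟩ := (Adj.of k A M).surjective m
    rw [Adj.smul_of (ℛ k a), RingHom.id_apply, LinearEquiv.symm_apply_apply,
      LinearEquiv.symm_apply_apply, Adj.smul_of (ℛ k a), map_sum]
    simp only [hφ.map_smul, hφ.map_op_smul]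

/-- The adjoint modules of `0 → M → Coind M → CoindQuot M → 0`. -/
noncomputable def adjShortComplex : ShortComplex (ModuleCat.{v} A) where
  X₁ := ModuleCat.of A (Adj k A M)
  X₂ := ModuleCat.of A (Adj k A (Coind k A M))
  X₃ := ModuleCat.of A (Adj k A (CoindQuot k A M))
  f := ModuleCat.ofHom (Adj.map Coind.isBimoduleHom_incl)
  g := ModuleCat.ofHom (Adj.map CoindQuot.isBimoduleHom_proj)
  zero := by
    ext m
    exact congrArg (Adj.of k A _) (CoindQuot.proj_incl _)

theorem adjShortComplex_shortExact : (adjShortComplex k A M).ShortExact := by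
  refine ModuleCat.shortComplex_shortExact _ ?_ ?_ ?_
  · intro φ
    constructor
    · intro h
      have h1 : CoindQuot.proj k A M ((Adj.of k A _).symm φ) = 0 := h
      have h2 := CoindQuot.incl_add_lift_proj ((Adj.of k A _).symm φ)
      rw [h1, map_zero, add_zero] at h2
      exact ⟨Adj.of k A M (Coind.evalOne k A M ((Adj.of k A _).symm φ)), congrArg (Adj.of k A _) h2⟩
    · rintro ⟨m, rfl⟩
      exact congrArg (Adj.of k A _) (CoindQuot.proj_incl _)
  · intro m n h
    have h1 : Coind.incl k A M ((Adj.of k A _).symm m) =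
      Coind.incl k A M ((Adj.of k A _).symm n) := h
    have h2 := congr(Coind.evalOne k A M $h1)
    rw [Coind.evalOne_apply, Coind.evalOne_apply, Coind.incl_apply, Coind.incl_apply, one_smul,
      one_smul] at h2
    exact (Adj.of k A M).symm.injective h2
  · intro φ
    exact ⟨Adj.of k A (Coind k A M) (CoindQuot.lift k A M ((Adj.of k A _).symm φ)),
      congrArg (Adj.of k A _) (CoindQuot.proj_lift _)⟩

/-- The projection of the adjoint module of `Coind` to the one of `CoindQuot`. -/
noncomputable def adjProj : ModuleCat.of A (Adj k A (Coind k A M)) ⟶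
    ModuleCat.of A (Adj k A (CoindQuot k A M)) :=
  ModuleCat.ofHom (Adj.map CoindQuot.isBimoduleHom_proj)

instance : Injective (adjShortComplex k A M).X₂ :=
  Module.injective_object_of_injective_module (inj := Adj.injective_adj_coind)

/-- Dimension shifting for Ext with coefficients in an adjoint module. -/
noncomputable def extAdjShift (X : ModuleCat.{v} A) (n : ℕ) :
    Ext X (ModuleCat.of A (Adj k A M)) (n + 1) ≃ₗ[k]
      Ext X (ModuleCat.of A (Adj k A (CoindQuot k A M))) n ⧸
        LinearMap.range ((Ext.mk₀ (adjProj k A M)).postcompOfLinear k X (add_zero n)) :=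
  extShift k X (adjShortComplex_shortExact k A M) n

/-- Dimension shifting in positive degrees for Ext with coefficients in an adjoint module. -/
noncomputable def extAdjShiftSucc (X : ModuleCat.{v} A) (n : ℕ) :
    Ext X (ModuleCat.of A (Adj k A M)) (n + 2) ≃ₗ[k]
      Ext X (ModuleCat.of A (Adj k A (CoindQuot k A M))) (n + 1) :=
  extShiftSucc k X (adjShortComplex_shortExact k A M) n

variable {k A M} in
theorem mem_cocycles_zero_iff (f : Cochain k A M 0) :
    f ∈ cocycles k A M 0 ↔ ∀ a : A, a • f 0 = MulOpposite.op a • f 0 := by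
  have h0 : ∀ x : Fin 0 → A, f x = f 0 := fun x ↦ congrArg f (Subsingleton.elim _ _)
  have h : ∀ a : Fin 1 → A, hochschildD k A M 0 f a = a 0 • f 0 - MulOpposite.op (a 0) • f 0 := by
    intro a
    simp [hochschildD_apply, h0, sub_eq_add_neg]
  constructor
  · intro hf a
    have := congr($(show hochschildD k A M 0 f = 0 from hf) (fun _ ↦ a))
    rw [h] at this
    exact sub_eq_zero.1 this
  · intro hf
    refine MultilinearMap.ext fun a ↦ ?_
    rw [h, hf, sub_self]
    rfl

variable {k A M} in
-- A zero-cocycle is a central element, on which the adjoint action is through the counit; hence its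
-- orbit map descends to A / ker ε.
theorem ker_counit_le_of_mem_cocycles {f : Cochain k A M 0} (hf : f ∈ cocycles k A M 0) :
    RingHom.ker (Bialgebra.counitAlgHom k A) ≤
      LinearMap.ker (LinearMap.toSpanSingleton A _ (Adj.of k A M (f 0))) := by
  intro a ha
  rw [LinearMap.mem_ker, LinearMap.toSpanSingleton_apply,
    (Adj.smul_of_eq_counit_smul_iff (f 0)).2 ((mem_cocycles_zero_iff f).1 hf) a]
  rw [show counit (R := k) a = 0 from ha, zero_smul]

/-- Hochschild cocycles in degree zero are the homomorphisms from the trivial module to the adjoint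
module. -/
noncomputable def cocyclesZeroMap : cocycles k A M 0 →ₗ[k]
    Ext (trivialModule (Bialgebra.counitAlgHom k A)) (ModuleCat.of A (Adj k A M)) 0 where
  toFun f := Ext.mk₀ (ModuleCat.ofHom (Submodule.liftQ _ _ (ker_counit_le_of_mem_cocycles f.2)))
  map_add' f g := by
    rw [← Ext.mk₀_add]
    congr 1
    ext : 1
    refine Submodule.linearMap_qext _ (LinearMap.ext_ring ?_)
    change (1 : A) • Adj.of k A M (f.1 0 + g.1 0) =
      (1 : A) • Adj.of k A M (f.1 0) + (1 : A) • Adj.of k A M (g.1 0)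
    simp
  map_smul' c f := by
    rw [RingHom.id_apply, ← Ext.mk₀_smul]
    congr 1
    ext : 1
    refine Submodule.linearMap_qext _ (LinearMap.ext_ring ?_)
    change (1 : A) • c • Adj.of k A M (f.1 0) = algebraMap k A c • (1 : A) • Adj.of k A M (f.1 0)
    simp

theorem cocyclesZeroMap_bijective : Function.Bijective (cocyclesZeroMap k A M) := by
  constructor
  · intro f g h
    have h1 := (Ext.mk₀_bijective _ _).1 h
    have h2 := congr(($h1).hom (Submodule.Quotient.mk 1))
    have h3 : (1 : A) • Adj.of k A M (f.1 0) = (1 : A) • Adj.of k A M (g.1 0) := h2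
    rw [one_smul, one_smul] at h3
    ext x
    rw [Subsingleton.elim x 0]
    exact h3
  · intro x
    obtain ⟨g, rfl⟩ := (Ext.mk₀_bijective _ _).2 x
    let m : M := (Adj.of k A M).symm (g.hom (Submodule.Quotient.mk 1))
    have hm : Adj.of k A M m = g.hom (Submodule.Quotient.mk 1) := rfl
    have hf : MultilinearMap.constOfIsEmpty k (fun _ : Fin 0 ↦ A) m ∈ cocycles k A M 0 := by
      rw [mem_cocycles_zero_iff, MultilinearMap.constOfIsEmpty_apply,
        ← Adj.smul_of_eq_counit_smul_iff (k := k)]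
      intro a
      -- The image of the class of 1 is an adjoint invariant because a and ε(a) agree modulo ker ε.
      have h : (Submodule.Quotient.mk (a • 1) :
          A ⧸ RingHom.ker (Bialgebra.counitAlgHom k A)) =
          Submodule.Quotient.mk (algebraMap k A (counit (R := k) a) • 1) := by
        rw [Submodule.Quotient.eq, RingHom.mem_ker]
        simp
      rw [← algebraMap_smul A (counit (R := k) a), Function.const_apply, hm, ← map_smul, ← map_smul,
        ← Submodule.Quotient.mk_smul, ← Submodule.Quotient.mk_smul, h]
    refine ⟨⟨_, hf⟩, ?_⟩
    change Ext.mk₀ _ = _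
    congr 1
    ext : 1
    refine Submodule.linearMap_qext _ (LinearMap.ext_ring ?_)
    change (1 : A) • Adj.of k A M m = g.hom (Submodule.Quotient.mk 1)
    rw [one_smul, hm]

/-- Hochschild cocycles in degree zero are the homomorphisms from the trivial module to the adjoint
module. -/
noncomputable def cocyclesZeroEquiv : cocycles k A M 0 ≃ₗ[k]
    Ext (trivialModule (Bialgebra.counitAlgHom k A)) (ModuleCat.of A (Adj k A M)) 0 :=
  LinearEquiv.ofBijective _ (cocyclesZeroMap_bijective k A M)

theorem cocyclesZeroEquiv_proj (z : cocycles k A (Coind k A M) 0)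
    (q : cocycles k A (CoindQuot k A M) 0) (h : Cochain.map A (CoindQuot.proj k A M) 0 z = q) :
    cocyclesZeroEquiv k A (CoindQuot k A M) q = (cocyclesZeroEquiv k A (Coind k A M) z).comp
      (Ext.mk₀ (adjProj k A M)) (add_zero 0) := by
  refine Eq.trans ?_ (Ext.mk₀_comp_mk₀ _ _).symm
  change Ext.mk₀ _ = _
  congr 1
  ext : 1
  refine Submodule.linearMap_qext _ (LinearMap.ext_ring ?_)
  have h1 := congr($h 0)
  change (1 : A) • Adj.of k A (CoindQuot k A M) (q.1 0) =
    Adj.map CoindQuot.isBimoduleHom_proj ((1 : A) • Adj.of k A (Coind k A M) (z.1 0))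
  rw [one_smul, one_smul, ← h1]
  rfl

/-- This matches the subspaces divided out by the two shifts from degree zero to degree one. -/
theorem map_liftableCocycles_zero :
    (liftableCocycles k A M 0).map (cocyclesZeroEquiv k A (CoindQuot k A M)).toLinearMap =
      LinearMap.range ((Ext.mk₀ (adjProj k A M)).postcompOfLinear k
        (trivialModule (Bialgebra.counitAlgHom k A)) (add_zero 0)) := by
  apply le_antisymm
  · rintro _ ⟨q, ⟨z, hz, hzq⟩, rfl⟩
    exact ⟨_, (cocyclesZeroEquiv_proj k A M ⟨z, hz⟩ q hzq).symm⟩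
  · rintro _ ⟨y, rfl⟩
    obtain ⟨z, rfl⟩ := (cocyclesZeroEquiv k A (Coind k A M)).surjective y
    have hq : Cochain.map A (CoindQuot.proj k A M) 0 z ∈ cocycles k A _ 0 :=
      CoindQuot.isBimoduleHom_proj.map_mem_cocycles z.2
    exact ⟨⟨_, hq⟩, ⟨z, z.2, rfl⟩, cocyclesZeroEquiv_proj k A M z ⟨_, hq⟩ rfl⟩

/-- Hochschild cohomology of a Hopf algebra is `Ext` from the trivial module to the adjoint
module. -/
theorem nonempty_hochschildCohomology_equiv_ext (n : ℕ) :
    Nonempty (HochschildCohomology k A M n ≃ₗ[k]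
      Ext (trivialModule (Bialgebra.counitAlgHom k A)) (ModuleCat.of A (Adj k A M)) n) := by
  match n with
  | 0 =>
    exact ⟨(Submodule.quotEquivOfEqBot _ (by
      simp [coboundaries, Submodule.submoduleOf])).trans (cocyclesZeroEquiv k A M)⟩
  | n + 1 =>
    -- Degree one is the base case: the shift from degree zero still has a quotient, while later
    -- shifts are isomorphisms. The coefficients change at each step.
    induction n generalizing M with
    | zero =>
      exact ⟨(hochschildShift k A M 0).trans ((Submodule.Quotient.equiv _ _
        (cocyclesZeroEquiv k A (CoindQuot k A M)) (map_liftableCocycles_zero k A M)).trans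
        (extAdjShift k A M _ 0).symm)⟩
    | succ n ih =>
      obtain ⟨e⟩ := ih (CoindQuot k A M)
      exact ⟨(hochschildShiftSucc k A M n).trans (e.trans
        (extAdjShiftSucc k A M _ n).symm)⟩

end Comparison

/-! ### The top cohomology and its relations for twisted bimodules -/

section Duality

open CategoryTheory Abelian MulOpposite

variable {k : Type u} {A : Type v} [Field k] [Ring A] [HopfAlgebra k A] {d : ℕ}

/-- The subspace of a bimodule spanned by all `a m - m ν(a)`. -/
def twistedCommutators (ν : A ≃ₐ[k] A) (M : Type v) [AddCommGroup M] [Module k M] [Module A M]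
    [Module Aᵐᵒᵖ M] : Submodule k M :=
  Submodule.span k {x : M | ∃ (a : A) (m : M), x = a • m - op (ν a) • m}

theorem nonempty_hochschildCohomology_equiv_quotient [IsNoetherianRing A]
    (hA : IsASRegular (Bialgebra.counitAlgHom k A) d)
    (hS : Function.Bijective (HopfAlgebra.antipode k : A →ₗ[k] A)) (M : Type v)
    [AddCommGroup M] [Module k M] [Module A M] [Module Aᵐᵒᵖ M] [SMulCommClass A Aᵐᵒᵖ M]
    [IsScalarTower k A M] [IsScalarTower k Aᵐᵒᵖ M] :
    Nonempty (HochschildCohomology k A M d ≃ₗ[k] M ⧸ twistedCommutators (nu hA.left hS) M) := by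
  obtain ⟨e⟩ := nonempty_hochschildCohomology_equiv_ext k A M d
  refine ⟨e.trans ((extTrivialEquiv hA (Adj k A M)).trans
    (Submodule.Quotient.equiv _ _ (Adj.of k A M) ?_).symm)⟩
  exact (span_twisted_commutators k A M (integralCharacter hA.left) (nu hA.left hS)
    fun _ ↦ rfl).symm

theorem subsingleton_hochschildCohomology (h : globalDimension A = d) {i : ℕ} (hi : d < i)
    (M : Type v) [AddCommGroup M] [Module k M] [Module A M] [Module Aᵐᵒᵖ M] [SMulCommClass A Aᵐᵒᵖ M]
    [IsScalarTower k A M] [IsScalarTower k Aᵐᵒᵖ M] :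
    Subsingleton (HochschildCohomology k A M i) := by
  obtain ⟨e⟩ := nonempty_hochschildCohomology_equiv_ext k A M i
  have := hasProjectiveDimensionLT_of_globalDimension_eq h
    (trivialModule (Bialgebra.counitAlgHom k A))
  have := HasProjectiveDimensionLT.subsingleton (trivialModule (Bialgebra.counitAlgHom k A))
    (d + 1) i hi (ModuleCat.of A (Adj k A M))
  exact e.toEquiv.subsingleton

/-- Applying ν⁻¹ to σ(a) m - m ν(a) gives ν⁻¹σ(a) m' - m' a with m' = ν⁻¹(m). -/
theorem map_twistedCommutators_twist (ν σ : A ≃ₐ[k] A) :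
    (twistedCommutators ν (Twist σ 1)).map ((Twist.of σ 1).symm ≪≫ₗ ν⁻¹.toLinearEquiv ≪≫ₗ
      Twist.of (ν⁻¹ * σ) 1).toLinearMap = commutatorSubspace k A (Twist (ν⁻¹ * σ) 1) := by
  have h : ∀ a m : A, ((Twist.of σ 1).symm ≪≫ₗ ν⁻¹.toLinearEquiv ≪≫ₗ Twist.of (ν⁻¹ * σ) 1)
      (a • Twist.of σ 1 m - op (ν a) • Twist.of σ 1 m) =
      a • Twist.of (ν⁻¹ * σ) 1 (ν⁻¹ m) - op a • Twist.of (ν⁻¹ * σ) 1 (ν⁻¹ m) := by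
    intro a m
    simp [Twist.smul_of, Twist.op_smul_of]
  rw [twistedCommutators, Submodule.map_span, commutatorSubspace]
  congr 1
  ext x
  constructor
  · rintro ⟨_, ⟨a, m, rfl⟩, rfl⟩
    obtain ⟨m, rfl⟩ := (Twist.of σ 1).surjective m
    exact ⟨a, _, h a m⟩
  · rintro ⟨a, m, rfl⟩
    obtain ⟨m, rfl⟩ := (Twist.of (ν⁻¹ * σ) 1).surjective m
    refine ⟨_, ⟨a, Twist.of σ 1 (ν m), rfl⟩, (h a (ν m)).trans ?_⟩
    rw [show ν⁻¹ (ν m) = m from ν.symm_apply_apply m]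

/-- For σ = ν the relations are ν(a) m - m ν(a), which are all commutators since ν is onto. -/
theorem map_twistedCommutators_twist_self (ν : A ≃ₐ[k] A) :
    (twistedCommutators ν (Twist ν 1)).map (Twist.of ν 1).symm.toLinearMap =
      commutatorSubspace k A A := by
  rw [twistedCommutators, Submodule.map_span, commutatorSubspace]
  congr 1
  ext x
  constructor
  · rintro ⟨_, ⟨a, m, rfl⟩, rfl⟩
    obtain ⟨m, rfl⟩ := (Twist.of ν 1).surjective m
    exact ⟨ν a, m, rfl⟩
  · rintro ⟨a, m, rfl⟩
    obtain ⟨a, rfl⟩ := ν.surjective a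
    exact ⟨_, ⟨a, Twist.of ν 1 m, rfl⟩, rfl⟩

theorem map_twistedCommutators_self (ν : A ≃ₐ[k] A) :
    (twistedCommutators ν A).map (Twist.of 1 ν).toLinearMap =
      commutatorSubspace k A (Twist 1 ν) := by
  rw [twistedCommutators, Submodule.map_span, commutatorSubspace]
  congr 1
  ext x
  constructor
  · rintro ⟨_, ⟨a, m, rfl⟩, rfl⟩
    exact ⟨a, Twist.of 1 ν m, rfl⟩
  · rintro ⟨a, m, rfl⟩
    obtain ⟨m, rfl⟩ := (Twist.of 1 ν).surjective m
    exact ⟨_, ⟨a, m, rfl⟩, rfl⟩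

/-- The commutator quotient of an augmented algebra is nonzero. -/
theorem nontrivial_quotient_commutatorSubspace {A : Type v} [Ring A] [Algebra k A]
    (ε : A →ₐ[k] k) : Nontrivial (A ⧸ commutatorSubspace k A A) := by
  rw [Submodule.Quotient.nontrivial_iff]
  -- Commutators die in the commutative field k, whereas ε(1) = 1.
  have h : commutatorSubspace k A A ≤ LinearMap.ker ε.toLinearMap := by
    refine Submodule.span_le.2 ?_
    rintro _ ⟨a, m, rfl⟩
    simp [mul_comm]
  intro htop
  have h1 : (1 : A) ∈ LinearMap.ker ε.toLinearMap := h (htop ▸ Submodule.mem_top)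
  simp at h1

end Duality

/-! ### The tensor product over the enveloping algebra -/

section EnvelopingTensor

variable (k : Type u) (A : Type v) (M : Type w) [Field k] [Ring A] [Algebra k A]
  [AddCommGroup M] [Module k M] [Module A M] [Module Aᵐᵒᵖ M] [SMulCommClass A Aᵐᵒᵖ M]
  [IsScalarTower k A M] [IsScalarTower k Aᵐᵒᵖ M]

/-- The map `A ⊗_{Aᵉ} M → M / [A, M]` induced by `x ⊗ m ↦ x m`. -/
def envelopingToQuotient : EnvelopingTensor k A M →ₗ[k] M ⧸ commutatorSubspace k A M :=
  Submodule.liftQ _ ((commutatorSubspace k A M).mkQ ∘ₗ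
    TensorProduct.lift (Algebra.lsmul k k M : A →ₐ[k] Module.End k M).toLinearMap) <| by
  refine Submodule.span_le.2 ?_
  rintro _ ⟨b, c, x, m, rfl⟩
  change (commutatorSubspace k A M).mkQ _ = 0
  rw [Submodule.mkQ_apply, Submodule.Quotient.mk_eq_zero]
  -- The relation maps to the commutator of c with x b m.
  refine Submodule.subset_span ⟨c, (x * b) • m, ?_⟩
  simp [mul_smul, smul_comm]

/-- The map `M / [A, M] → A ⊗_{Aᵉ} M` induced by `m ↦ 1 ⊗ m`. -/
def quotientToEnveloping : M ⧸ commutatorSubspace k A M →ₗ[k] EnvelopingTensor k A M :=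
  Submodule.liftQ _ ((envelopingRelations k A M).mkQ ∘ₗ TensorProduct.mk k A M 1) <| by
  refine Submodule.span_le.2 ?_
  rintro _ ⟨a, m, rfl⟩
  change (envelopingRelations k A M).mkQ _ = 0
  rw [Submodule.mkQ_apply, Submodule.Quotient.mk_eq_zero]
  -- Both 1 ⊗ a m and 1 ⊗ m a are congruent to a ⊗ m.
  have h1 : a ⊗ₜ[k] m - 1 ⊗ₜ[k] (a • m) ∈ envelopingRelations k A M :=
    Submodule.subset_span ⟨a, 1, 1, m, by simp⟩
  have h2 : a ⊗ₜ[k] m - 1 ⊗ₜ[k] (MulOpposite.op a • m) ∈ envelopingRelations k A M :=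
    Submodule.subset_span ⟨1, a, 1, m, by simp⟩
  have h3 := Submodule.sub_mem _ h2 h1
  rwa [sub_sub_sub_cancel_left, ← TensorProduct.tmul_sub] at h3

/-- The identification `A ⊗_{Aᵉ} M = M / [A, M]`. -/
def envelopingEquiv : EnvelopingTensor k A M ≃ₗ[k] M ⧸ commutatorSubspace k A M :=
  LinearEquiv.ofLinearMap (envelopingToQuotient k A M) (quotientToEnveloping k A M)
    (Submodule.linearMap_qext _ (LinearMap.ext fun m ↦
      congrArg (commutatorSubspace k A M).mkQ (one_smul A m)))
    (Submodule.linearMap_qext _ (TensorProduct.ext' fun x m ↦ by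
      symm
      change (envelopingRelations k A M).mkQ (x ⊗ₜ[k] m) =
        (envelopingRelations k A M).mkQ (1 ⊗ₜ[k] (x • m))
      rw [← sub_eq_zero, ← map_sub, Submodule.mkQ_apply, Submodule.Quotient.mk_eq_zero]
      exact Submodule.subset_span ⟨x, 1, 1, m, by simp⟩))

end EnvelopingTensor

end HopfDuality

/-! ### The duality theorem -/

theorem theorem5p3 {k : Type u} {A : Type v} [Field k] [Ring A] [HopfAlgebra k A]
    [IsNoetherianRing A] [IsNoetherianRing Aᵐᵒᵖ] (d : ℕ)
    (hA : HopfDuality.IsASRegular (Bialgebra.counitAlgHom k A) d)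
    (hS : Function.Bijective (HopfAlgebra.antipode k : A →ₗ[k] A))
    (ν : A ≃ₐ[k] A) (hν : ν = HopfDuality.nu hA.left hS) :
    (∀ σ : A ≃ₐ[k] A,
      Nonempty (HopfDuality.HochschildCohomology k A (HopfDuality.Twist σ 1) d ≃ₗ[k]
        HopfDuality.EnvelopingTensor k A (HopfDuality.Twist (ν⁻¹ * σ) 1)) ∧
      (∃ e : HopfDuality.EnvelopingTensor k A (HopfDuality.Twist (ν⁻¹ * σ) 1) ≃ₗ[k]
          (HopfDuality.Twist (ν⁻¹ * σ) 1 ⧸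
            HopfDuality.commutatorSubspace k A (HopfDuality.Twist (ν⁻¹ * σ) 1)),
        ∀ (x : A) (m : HopfDuality.Twist (ν⁻¹ * σ) 1),
          e (Submodule.Quotient.mk (TensorProduct.tmul k x m)) =
            Submodule.Quotient.mk (x • m)) ∧
      Nonempty (HopfDuality.HochschildCohomology k A (HopfDuality.Twist σ 1) d ≃ₗ[k]
        (HopfDuality.Twist (ν⁻¹ * σ) 1 ⧸
          HopfDuality.commutatorSubspace k A (HopfDuality.Twist (ν⁻¹ * σ) 1)))) ∧
    Nonempty (HopfDuality.HochschildCohomology k A (HopfDuality.Twist ν 1) d ≃ₗ[k]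
      (A ⧸ HopfDuality.commutatorSubspace k A A)) ∧
    Nontrivial (A ⧸ HopfDuality.commutatorSubspace k A A) ∧
    HopfDuality.THcodimEq k A d ∧
    (HopfDuality.HcodimEq k A d ↔
      Nontrivial (HopfDuality.Twist 1 ν ⧸
        HopfDuality.commutatorSubspace k A (HopfDuality.Twist 1 ν))) := by
  have key := fun σ : A ≃ₐ[k] A ↦
    HopfDuality.nonempty_hochschildCohomology_equiv_quotient hA hS (HopfDuality.Twist σ 1)
  rw [← hν] at key
  have hnt := HopfDuality.nontrivial_quotient_commutatorSubspace (Bialgebra.counitAlgHom k A)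
  have hself : Nonempty (HopfDuality.HochschildCohomology k A (HopfDuality.Twist ν 1) d ≃ₗ[k]
      (A ⧸ HopfDuality.commutatorSubspace k A A)) := by
    obtain ⟨e⟩ := key ν
    exact ⟨e.trans (Submodule.Quotient.equiv _ _ _
      (HopfDuality.map_twistedCommutators_twist_self ν))⟩
  refine ⟨fun σ ↦ ?_, hself, hnt, ⟨?_, ?_⟩, ?_⟩
  · obtain ⟨e⟩ := key σ
    have f := e.trans (Submodule.Quotient.equiv _ _ _
      (HopfDuality.map_twistedCommutators_twist ν σ))
    exact ⟨⟨f.trans (HopfDuality.envelopingEquiv k A _).symm⟩,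
      ⟨HopfDuality.envelopingEquiv k A _, fun _ _ ↦ rfl⟩, ⟨f⟩⟩
  · obtain ⟨e⟩ := hself
    exact ⟨ν, e.toEquiv.nontrivial⟩
  · rintro i ⟨σ, hσ⟩
    by_contra! hi
    exact not_subsingleton_iff_nontrivial.2 hσ
      (HopfDuality.subsingleton_hochschildCohomology hA.globalDimension_eq hi _)
  · obtain ⟨e⟩ := HopfDuality.nonempty_hochschildCohomology_equiv_quotient hA hS A
    rw [← hν] at e
    -- With coefficients in A the relations a m - m ν(a) are the commutators of A^ν.
    let f := e.trans (Submodule.Quotient.equiv _ _ _ (HopfDuality.map_twistedCommutators_self ν))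
    refine ⟨fun h ↦ ?_, fun h ↦ ⟨f.toEquiv.nontrivial, ?_⟩⟩
    · have : Nontrivial (HopfDuality.HochschildCohomology k A A d) := h.1
      exact f.symm.toEquiv.nontrivial
    · intro i hσ
      by_contra! hi
      exact not_subsingleton_iff_nontrivial.2 hσ
        (HopfDuality.subsingleton_hochschildCohomology hA.globalDimension_eq hi _)
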